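/- **Setting.** Let $\chi$ be a topological space with a $\sigma$-algebra and a $\sigma$-finite measure $\nu$, and let $\mu$ be a $\sigma$-finite measure on $\mathbb R^d$. Let $\Theta\subset\mathbb R^d$ be finite with $\mu(\{\theta\})>0$ for all $\theta\in\Theta$, let $\widehat\Theta\supseteq\Theta$ be closed and convex, $\Theta_H\subseteq\widehat\Theta$ finite and $\chi_c\subseteq\chi$ compact. For each $\theta\in\widehat\Theta$ let $p(\cdot\mid\theta)$ be a probability density with respect to $\nu$. A mixing density on $\Theta$ is a probability density $g\ge 0$ with respect to $\mu$ that vanishes outside $\Theta$; put $m_g(x)=\int p(x\mid\theta)g(\theta)\,d\mu(\theta)$. Assume that the mixing density is identifiable: if $g_1,g_2$ are mixing densities on $\Theta$ and $m_{g_1}=m_{g_2}$ $\nu$-a.e., then $g_1=g_2$. Let $f$ and $f_0$ be mixing densities on $\Theta$ that are positive at every point of $\Theta$, and write $m=m_f$. Let $X_1,X_2,\dots$ be $\chi$-valued random variables on a probability space, each with marginal density $m$ with respect to $\nu$, such that for all $i,n\ge 1$ the variable $X_{i+n}$ has a conditional density $m(\cdot\mid X_{1:i})$ with respect to $\nu$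 given $X_{1:i}=(X_1,\dots,X_i)$, and, for some $c_0>0$ and $0<\rho<1$, $$\sup_{i\ge1}\,E\Big[\int\Big(\frac{m(x\mid X_{1:i})}{m(x)}-1\Big)^2m(x)\,\nu(dx)\Big]\le c_0^2\rho^{2n}\qquad\text{for all } n\ge 1 .$$ Let $w_1,w_2,\dots\in(0,1]$ be weights and define the predictive recursion estimates, for $i\ge1$, by $$f_i(\theta)=(1-w_i)f_{i-1}(\theta)+w_i\frac{p(X_i\mid\theta)f_{i-1}(\theta)}{m_{f_{i-1}}(X_i)} .$$ Assume the following conditions, where likelihood ratios take values in $[0,\infty]$ (with $c/0=\infty$ for $c>0$ and $0/0=0$). - **B1.** $w_i$ is non-increasing with limit $0$, and for some $\alpha\in(1/2,1]$ it is of exact order $i^{-\alpha}$: there are $0<k_1\le k_2$ with $k_1i^{-\alpha}\le w_i\le k_2i^{-\alpha}$ for all large $i$. - **B2.** There is $b_0>0$ such that, for all distinct indices $j_1,\dots,j_k\ge1$ and all $\theta_{l},\theta'_{l}\in\widehat\Theta$ ($1\le l\le k$), $$E\Big[\Big(\prod_{l=1}^{k}\frac{p(X_{j_l}\mid\theta_l)}{p(X_{j_l}\mid\theta'_l)}\Big)^2\Big]\le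 b_0^{2k}\prod_{l=1}^{k}E\Big[\Big(\frac{p(X_{j_l}\mid\theta_l)}{p(X_{j_l}\mid\theta'_l)}\Big)^2\Big].$$ - **B3.** $\displaystyle\sup_{\theta_1,\theta_2,\theta_3\in\widehat\Theta}\int\Big(\frac{p(x\mid\theta_1)}{p(x\mid\theta_2)}\Big)^2p(x\mid\theta_3)\,\nu(dx)<\infty.$ - **B4.** For every $x\in\chi$ the map $\theta\mapsto p(x\mid\theta)$ is bounded and continuous on $\Theta$. - **C1.** There is $c_u>1$ such that for every $x\notin\chi_c$ there are $\theta^x_1,\theta^x_2\in\Theta_H$ with $\displaystyle\sup_{\theta,\theta'\in\Theta}\frac{p(x\mid\theta)}{p(x\mid\theta')}\le c_u\frac{p(x\mid\theta^x_2)}{p(x\mid\theta^x_1)}.$ - **C2.** There is $a>0$ with $p(x\mid\theta)>a$ for all $x\in\chi_c$, $\theta\in\Theta$. - **C3.** There is $b<\infty$ with $p(x\mid\theta)<b$ for all $x\in\chi_c$, $\theta\in\Theta$. **Theorem.** With probability one, $f_n(\theta)\to f(\theta)$ as $n\to\infty$ for every $\theta$; that is, the predictive recursion estimate $f_n$ converges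 almost surely to the true mixing density $f$. -/

import Mathlib

open MeasureTheory Filter Topology
open scoped ENNReal

namespace PredictiveRecursion

noncomputable section

/-- The mixture `m_g(x) = ∫ p(x | θ) g(θ) dμ(θ)`. -/
def mixture {χ E : Type*} [MeasurableSpace E] (p : χ → E → ℝ) (μ : Measure E)
    (g : E → ℝ) (x : χ) : ℝ :=
  ∫ θ, p x θ * g θ ∂μ

/-- The predictive recursion driven by the data `x 1, x 2, …` (the value `x 0` is not used):
`f_i(θ) = (1 - w_i) f_{i-1}(θ) + w_i p(x_i | θ) f_{i-1}(θ) / m_{i-1}(x_i)`, where `m_{i-1}` is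
the mixture with mixing density `f_{i-1}`. -/
def estimate {χ E : Type*} [MeasurableSpace E] (p : χ → E → ℝ) (μ : Measure E)
    (w : ℕ → ℝ) (f₀ : E → ℝ) (x : ℕ → χ) : ℕ → E → ℝ
  | 0 => f₀
  | i + 1 => fun θ =>
      (1 - w (i + 1)) * estimate p μ w f₀ x i θ
        + w (i + 1) * (p (x (i + 1)) θ * estimate p μ w f₀ x i θ
            / mixture p μ (estimate p μ w f₀ x i) (x (i + 1)))

/-- For every `θ` in `S`, `x ↦ p(x | θ)` is a probability density with respect to `ν`. -/
def IsDensityFamily {χ E : Type*} [MeasurableSpace χ] (ν : Measure χ) (S : Set E)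
    (p : χ → E → ℝ) : Prop :=
  ∀ θ ∈ S, Measurable (fun x => p x θ) ∧ (∀ x, 0 ≤ p x θ) ∧
    ∫⁻ x, ENNReal.ofReal (p x θ) ∂ν = 1

/-- `g` is a probability density with respect to `μ` that vanishes outside `S`. -/
def IsMixingDensityOn {E : Type*} [MeasurableSpace E] (μ : Measure E) (S : Set E)
    (g : E → ℝ) : Prop :=
  (∀ θ, 0 ≤ g θ) ∧ (∀ θ, θ ∉ S → g θ = 0) ∧ ∫ θ, g θ ∂μ = 1

/-- Identifiability: among mixing densities on `S`, the mixture (as a `ν`-density, that is up to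
`ν`-null sets) determines the mixing density. -/
def Identifiable {χ E : Type*} [MeasurableSpace χ] [MeasurableSpace E] (ν : Measure χ)
    (μ : Measure E) (S : Set E) (p : χ → E → ℝ) : Prop :=
  ∀ g₁ g₂ : E → ℝ, IsMixingDensityOn μ S g₁ → IsMixingDensityOn μ S g₂ →
    mixture p μ g₁ =ᵐ[ν] mixture p μ g₂ → g₁ = g₂

/-- The likelihood ratio `p(x | θ₁) / p(x | θ₂)`, with values in `[0, ∞]`: it is `∞` when only the
denominator vanishes (and `0 / 0 = 0`). -/
def ratio {χ E : Type*} (p : χ → E → ℝ) (x : χ) (θ₁ θ₂ : E) : ℝ≥0∞ :=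
  ENNReal.ofReal (p x θ₁) / ENNReal.ofReal (p x θ₂)

/-- The initial segment `X_{1:i} = (X_1, …, X_i)`. -/
def past {χ Ω : Type*} (X : ℕ → Ω → χ) (i : ℕ) (ω : Ω) : Fin i → χ :=
  fun k => X ((k : ℕ) + 1) ω

/-- `q y x` is a conditional density at `x`, with respect to `ν`, of `Z` given `Y = y`. -/
def IsCondDensity {Ω β χ : Type*} [MeasurableSpace Ω] [MeasurableSpace β] [MeasurableSpace χ]
    (P : Measure Ω) (ν : Measure χ) (Y : Ω → β) (Z : Ω → χ) (q : β → χ → ℝ) : Prop :=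
  Measurable (Function.uncurry q) ∧ (∀ y x, 0 ≤ q y x) ∧
    P.map (fun ω => (Y ω, Z ω)) =
      ((P.map Y).prod ν).withDensity (fun z => ENNReal.ofReal (q z.1 z.2))

/-- Exponentially decaying dependence: the expected chi-square distance between the conditional
density of `X_{i+n}` given `X_{1:i}` and the marginal density `m` is at most `c₀² ρ^{2n}`,
uniformly in `i`. -/
def DependenceDecay {Ω χ : Type*} [MeasurableSpace Ω] [MeasurableSpace χ]
    (P : Measure Ω) (ν : Measure χ) (X : ℕ → Ω → χ) (m : χ → ℝ) : Prop :=
  ∃ c₀ ρ : ℝ, 0 < c₀ ∧ 0 < ρ ∧ ρ < 1 ∧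
    ∀ i n : ℕ, 1 ≤ i → 1 ≤ n →
      ∃ q : (Fin i → χ) → χ → ℝ, IsCondDensity P ν (past X i) (X (i + n)) q ∧
        ∫⁻ ω, ∫⁻ x, ENNReal.ofReal ((q (past X i ω) x / m x - 1) ^ 2 * m x) ∂ν ∂P
          ≤ ENNReal.ofReal (c₀ ^ 2 * ρ ^ (2 * n))

/-- B1. The weights `w_1, w_2, …` decrease to `0` and are of exact order `i^{-α}` for some
`α ∈ (1/2, 1]`. -/
def CondB1 (w : ℕ → ℝ) : Prop :=
  AntitoneOn w (Set.Ici 1) ∧ Tendsto w atTop (𝓝 0) ∧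
    ∃ α : ℝ, 1 / 2 < α ∧ α ≤ 1 ∧
      Asymptotics.IsTheta atTop w (fun i : ℕ => (i : ℝ) ^ (-α))

/-- B2. Second moments of products of likelihood ratios over distinct indices. The finite set `J`
is the set of the indices `j_l`. -/
def CondB2 {Ω χ E : Type*} [MeasurableSpace Ω] (P : Measure Ω) (X : ℕ → Ω → χ)
    (p : χ → E → ℝ) (S : Set E) : Prop :=
  ∃ b₀ : ℝ, 0 < b₀ ∧
    ∀ (J : Finset ℕ) (θ₁ θ₂ : ℕ → E), (∀ j ∈ J, 1 ≤ j ∧ θ₁ j ∈ S ∧ θ₂ j ∈ S) →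
      ∫⁻ ω, (∏ j ∈ J, ratio p (X j ω) (θ₁ j) (θ₂ j)) ^ 2 ∂P
        ≤ ENNReal.ofReal b₀ ^ (2 * J.card) *
          ∏ j ∈ J, ∫⁻ ω, ratio p (X j ω) (θ₁ j) (θ₂ j) ^ 2 ∂P

/-- B3. Uniformly bounded second moments of likelihood ratios, under every `p(· | θ₃)`. -/
def CondB3 {χ E : Type*} [MeasurableSpace χ] (ν : Measure χ) (p : χ → E → ℝ)
    (S : Set E) : Prop :=
  ∃ B : ℝ, ∀ θ₁ ∈ S, ∀ θ₂ ∈ S, ∀ θ₃ ∈ S,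
    ∫⁻ x, ratio p x θ₁ θ₂ ^ 2 * ENNReal.ofReal (p x θ₃) ∂ν ≤ ENNReal.ofReal B

/-- B4. For each `x`, the map `θ ↦ p(x | θ)` is bounded and continuous on the parameter set. -/
def CondB4 {χ E : Type*} [TopologicalSpace E] (p : χ → E → ℝ) (S : Set E) : Prop :=
  ∀ x, ContinuousOn (p x) S ∧ ∃ M : ℝ, ∀ θ ∈ S, |p x θ| ≤ M

/-- C1. Outside `χc`, likelihood ratios over `S` are controlled by those at the points of `H`. -/
def CondC1 {χ E : Type*} (p : χ → E → ℝ) (S H : Set E) (χc : Set χ) : Prop :=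
  ∃ cu : ℝ, 1 < cu ∧ ∀ x, x ∉ χc → ∃ θ₁ ∈ H, ∃ θ₂ ∈ H, ∀ θ ∈ S, ∀ θ' ∈ S,
    ratio p x θ θ' ≤ ENNReal.ofReal cu * ratio p x θ₂ θ₁

/-- C2. The kernel is bounded away from zero on `χc`. -/
def CondC2 {χ E : Type*} (p : χ → E → ℝ) (S : Set E) (χc : Set χ) : Prop :=
  ∃ a : ℝ, 0 < a ∧ ∀ x ∈ χc, ∀ θ ∈ S, a < p x θ

/-- C3. The kernel is bounded above on `χc`. -/
def CondC3 {χ E : Type*} (p : χ → E → ℝ) (S : Set E) (χc : Set χ) : Prop :=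
  ∃ b : ℝ, ∀ x ∈ χc, ∀ θ ∈ S, p x θ < b

end

end PredictiveRecursion

/-! On a finite `Θ` the estimates are points of a simplex (`masses`), and the recursion is a
stochastic approximation scheme whose Lyapunov function is the Kullback–Leibler divergence `kl π u`
from the true weights π to the current weights u. One step with small weight w adds at most -w
(m_π/m_u - 1) + w² R², evaluated at the new observation, where R, the `spread`, is the sum of all
likelihood ratios and dominates every mixture ratio uniformly in u (`kl_step_le`). Condition B3 puts
R in L² of the marginal law L (`memLp_spread_of_condB3`). The L-mean of m_π/m_u - 1 is at least the
L-mean of (m_u - m_π)²/(m_u m_π), so the drift has the right sign, and by identifiability it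
vanishes only at u = π.

The obstacle is dependence: X_i is not independent of the weights at time i - 1. Time is cut at
boundaries t_j, and on the block (t_{j+1}, t_{j+2}] the ratios are evaluated at the weights of time
t_j, a whole block earlier. Moving the anchor costs a term quadratic in block weights, summable if
blocks are short; the gap makes the conditional mean of the noise exponentially small in the block
length, summable if blocks are long. Lengths of order j^δ with a small δ > 0 achieve both because α
> 1/2 (`exists_block_boundaries`). The rest of the noise splits into two L²-bounded martingales
(`ae_exists_tendsto_sum_blockNoise`).

Hence, almost surely, the divergence at block boundaries decreases up to a convergent series. It
converges, and since the block weights are not summable (α ≤ 1), the drift is arbitrarily small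
infinitely often. Compactness of the simplex and continuity of the drift force the limit to be 0
(`kl_tendsto_zero_of_frequently`). The divergence dominates the squared Hellinger distance, so the
weights converge along the boundaries; steps of ℓ¹ size at most 2w fill in the blocks. -/

namespace PredictiveRecursion

/-! ### One step of the recursion on a simplex, and the Kullback–Leibler divergence. -/

section Finite

variable {ι : Type*} [Fintype ι]

/-- The mixture of the values `a` with weights `u`. -/
noncomputable def mix (a u : ι → ℝ) : ℝ := ∑ i, u i * a i

/-- One step of the predictive recursion for weights on a finite set. -/
noncomputable def step (w : ℝ) (a u : ι → ℝ) : ι → ℝ :=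
  fun i => (1 - w) * u i + w * (a i * u i / mix a u)

/-- The sum of all the likelihood ratios. -/
noncomputable def spread (a : ι → ℝ) : ℝ := ∑ i, ∑ j, a i / a j

/-- The Kullback-Leibler divergence on a finite set. -/
noncomputable def kl (π u : ι → ℝ) : ℝ := ∑ i, π i * Real.log (π i / u i)

variable {a u v π : ι → ℝ} {w : ℝ}

lemma nonempty_of_mem_stdSimplex (hu : u ∈ stdSimplex ℝ ι) : Nonempty ι := by
  by_contra h
  rw [not_nonempty_iff] at h
  simpa using hu.2

lemma mix_pos (ha : ∀ i, 0 < a i) (hu : u ∈ stdSimplex ℝ ι) : 0 < mix a u := by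
  have h1 : 0 < ∑ i, u i := by rw [hu.2]; exact one_pos
  obtain ⟨i, hi, hpos⟩ := Finset.exists_lt_of_sum_lt
    (s := Finset.univ) (f := fun _ => (0 : ℝ)) (g := u) (by simpa using h1)
  exact Finset.sum_pos' (fun j _ => mul_nonneg (hu.1 j) (ha j).le)
    ⟨i, hi, mul_pos hpos (ha i)⟩

lemma spread_nonneg (ha : ∀ i, 0 ≤ a i) : 0 ≤ spread a :=
  Finset.sum_nonneg fun i _ => Finset.sum_nonneg fun j _ => div_nonneg (ha i) (ha j)

lemma div_le_spread (ha : ∀ i, 0 ≤ a i) (i j : ι) : a i / a j ≤ spread a :=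
  (Finset.single_le_sum (f := fun j => a i / a j) (fun j _ => div_nonneg (ha i) (ha j))
    (Finset.mem_univ j)).trans
    (Finset.single_le_sum (f := fun i => ∑ j, a i / a j)
      (fun i _ => Finset.sum_nonneg fun j _ => div_nonneg (ha i) (ha j)) (Finset.mem_univ i))

lemma le_spread_mul (ha : ∀ i, 0 < a i) (i j : ι) : a i ≤ spread a * a j :=
  (div_le_iff₀ (ha j)).1 (div_le_spread (fun i => (ha i).le) i j)

lemma one_le_spread [Nonempty ι] (ha : ∀ i, 0 < a i) : 1 ≤ spread a := by
  obtain ⟨i⟩ := ‹Nonempty ι›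
  simpa [(ha i).ne'] using div_le_spread (fun i => (ha i).le) i i

lemma le_spread_mul_mix (ha : ∀ i, 0 < a i) (hu : u ∈ stdSimplex ℝ ι) (i : ι) :
    a i ≤ spread a * mix a u := by
  calc a i = ∑ j, u j * a i := by rw [← Finset.sum_mul, hu.2, one_mul]
    _ ≤ ∑ j, spread a * (u j * a j) := Finset.sum_le_sum fun j _ => by
        have := mul_le_mul_of_nonneg_left (le_spread_mul ha i j) (hu.1 j)
        linarith
    _ = _ := by rw [← Finset.mul_sum]; rfl

lemma div_mix_le (ha : ∀ i, 0 < a i) (hu : u ∈ stdSimplex ℝ ι) (i : ι) :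
    a i / mix a u ≤ spread a :=
  (div_le_iff₀ (mix_pos ha hu)).2 (le_spread_mul_mix ha hu i)

lemma mix_div_mix_nonneg (ha : ∀ i, 0 < a i) (hπ : π ∈ stdSimplex ℝ ι)
    (hu : u ∈ stdSimplex ℝ ι) : 0 ≤ mix a π / mix a u :=
  div_nonneg (mix_pos ha hπ).le (mix_pos ha hu).le

lemma mix_div_mix_eq : mix a π / mix a u = ∑ i, π i * (a i / mix a u) := by
  simp only [mix, Finset.sum_div, mul_div_assoc]

lemma mix_div_mix_le (ha : ∀ i, 0 < a i) (hπ : π ∈ stdSimplex ℝ ι)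
    (hu : u ∈ stdSimplex ℝ ι) : mix a π / mix a u ≤ spread a := by
  rw [mix_div_mix_eq]
  calc _ ≤ ∑ i, π i * spread a :=
        Finset.sum_le_sum fun i _ => mul_le_mul_of_nonneg_left (div_mix_le ha hu i) (hπ.1 i)
    _ = _ := by rw [← Finset.sum_mul, hπ.2, one_mul]

/-- The difference factors as (m_π/m_u) · ∑ (v_i - u_i) a_i/m_v, and `spread` bounds each of the two
kinds of ratio. This Lipschitz estimate pays for moving the anchor, and also gives continuity of the
drift. -/
lemma abs_mix_div_mix_sub_le (ha : ∀ i, 0 < a i) (hπ : π ∈ stdSimplex ℝ ι)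
    (hu : u ∈ stdSimplex ℝ ι) (hv : v ∈ stdSimplex ℝ ι) :
    |mix a π / mix a u - mix a π / mix a v| ≤ spread a ^ 2 * ∑ i, |u i - v i| := by
  have hmu := mix_pos ha hu
  have hmv := mix_pos ha hv
  have h0 : 0 ≤ spread a := spread_nonneg fun i => (ha i).le
  have h1 : mix a π / mix a u - mix a π / mix a v
      = mix a π / mix a u * ∑ i, (v i - u i) * (a i / mix a v) := by
    have : ∑ i, (v i - u i) * (a i / mix a v) = (mix a v - mix a u) / mix a v := by
      simp only [mix, sub_mul, Finset.sum_sub_distrib, sub_div, Finset.sum_div, mul_div_assoc]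
    rw [this]
    field_simp
  rw [h1, abs_mul, abs_of_nonneg (mix_div_mix_nonneg ha hπ hu), pow_two, mul_assoc]
  refine mul_le_mul (mix_div_mix_le ha hπ hu) ?_ (abs_nonneg _) h0
  rw [Finset.mul_sum]
  refine (Finset.abs_sum_le_sum_abs _ _).trans (Finset.sum_le_sum fun i _ => ?_)
  rw [abs_mul, abs_sub_comm, abs_of_nonneg (div_nonneg (ha i).le hmv.le), mul_comm]
  exact mul_le_mul_of_nonneg_right (div_mix_le ha hv i) (abs_nonneg _)

lemma sum_mul_div_mix (ha : ∀ i, 0 < a i) (hu : u ∈ stdSimplex ℝ ι) :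
    ∑ i, a i * u i / mix a u = 1 := by
  rw [← Finset.sum_div]
  have : ∑ i, a i * u i = mix a u := Finset.sum_congr rfl fun i _ => mul_comm _ _
  rw [this, div_self (mix_pos ha hu).ne']

lemma step_mem_stdSimplex (ha : ∀ i, 0 < a i) (hw0 : 0 ≤ w) (hw1 : w ≤ 1)
    (hu : u ∈ stdSimplex ℝ ι) : step w a u ∈ stdSimplex ℝ ι := by
  refine ⟨fun i => ?_, ?_⟩
  · have := mul_nonneg (ha i).le (hu.1 i)
    exact add_nonneg (mul_nonneg (by linarith) (hu.1 i))
      (mul_nonneg hw0 (div_nonneg this (mix_pos ha hu).le))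
  · simp only [step, Finset.sum_add_distrib, ← Finset.mul_sum, sum_mul_div_mix ha hu, hu.2]
    ring

lemma step_pos (ha : ∀ i, 0 < a i) (hw0 : 0 < w) (hw1 : w ≤ 1)
    (hu : u ∈ stdSimplex ℝ ι) (hpos : ∀ i, 0 < u i) (i : ι) : 0 < step w a u i := by
  have h1 : 0 < a i * u i / mix a u := div_pos (mul_pos (ha i) (hpos i)) (mix_pos ha hu)
  exact add_pos_of_nonneg_of_pos (mul_nonneg (by linarith) (hpos i).le) (mul_pos hw0 h1)

lemma sum_abs_step_sub_le (ha : ∀ i, 0 < a i) (hw0 : 0 ≤ w) (hu : u ∈ stdSimplex ℝ ι) :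
    ∑ i, |step w a u i - u i| ≤ 2 * w := by
  have h : ∀ i, |step w a u i - u i| ≤ w * (a i * u i / mix a u) + w * u i := fun i => by
    have h1 : 0 ≤ a i * u i / mix a u :=
      div_nonneg (mul_nonneg (ha i).le (hu.1 i)) (mix_pos ha hu).le
    have h2 := mul_nonneg hw0 h1
    have h3 := mul_nonneg hw0 (hu.1 i)
    rw [abs_le]
    constructor <;> simp only [step] <;> linarith
  refine (Finset.sum_le_sum fun i _ => h i).trans ?_
  rw [Finset.sum_add_distrib, ← Finset.mul_sum, ← Finset.mul_sum, sum_mul_div_mix ha hu, hu.2]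
  linarith

/-- For negative t this is the second-order Taylor expansion, whose cubic remainder is absorbed in
t²/2 as long as 1 + 3t ≥ 0; the bound -1/4 leaves room for that. -/
lemma sub_sq_le_log_one_add {t : ℝ} (ht : -(1 / 4) ≤ t) : t - t ^ 2 ≤ Real.log (1 + t) := by
  have h1 : 0 < 1 + t := by linarith
  rcases le_or_gt 0 t with h | h
  · have := Real.one_sub_inv_le_log_of_pos h1
    refine le_trans ?_ this
    have : 1 - (1 + t)⁻¹ = t / (1 + t) := by field_simp; ring
    rw [this, le_div_iff₀ h1]
    nlinarith [pow_nonneg h 3]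
  · have h2 := Real.abs_log_sub_add_sum_range_le (x := -t)
      (by rw [abs_neg, abs_of_neg h]; linarith) 2
    rw [abs_neg, abs_of_neg h] at h2
    simp only [Finset.sum_range_succ, Finset.sum_range_zero, sub_neg_eq_add] at h2
    norm_num at h2
    have h3 : (-t) ^ 3 / (1 + t) ≤ t ^ 2 / 2 := by
      rw [div_le_iff₀ h1]
      nlinarith [mul_nonneg (sq_nonneg t) (by linarith : 0 ≤ 1 + 3 * t)]
    have h4 := (abs_le.1 h2).1
    linarith

/-- A step multiplies u_i by 1 + t_i with t_i = w (a_i/m_u - 1), so the divergence changes by -∑ π_i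
log(1 + t_i). The linear part averages to the drift, and |t_i| ≤ w · `spread` bounds the quadratic
part. The restriction w ≤ 1/4 ensures t_i ≥ -1/4. -/
lemma kl_step_le (ha : ∀ i, 0 < a i) (hw0 : 0 < w) (hw1 : w ≤ 1 / 4)
    (hπ : π ∈ stdSimplex ℝ ι) (hπpos : ∀ i, 0 < π i)
    (hu : u ∈ stdSimplex ℝ ι) (hpos : ∀ i, 0 < u i) :
    kl π (step w a u) ≤ kl π u - w * (mix a π / mix a u - 1) + w ^ 2 * spread a ^ 2 := by
  have : Nonempty ι := nonempty_of_mem_stdSimplex hu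
  have hs1 := one_le_spread ha
  have key : ∀ i, π i * Real.log (π i / step w a u i) ≤ π i * Real.log (π i / u i)
      - w * (π i * (a i / mix a u) - π i) + π i * (w ^ 2 * spread a ^ 2) := fun i => by
    set t := w * (a i / mix a u - 1) with ht
    have hr0 : 0 ≤ a i / mix a u := div_nonneg (ha i).le (mix_pos ha hu).le
    have hr1 := div_mix_le ha hu i
    have hst : step w a u i = u i * (1 + t) := by simp only [step, ht]; ring
    have htl : -(1 / 4) ≤ t := by nlinarith [mul_nonneg hw0.le hr0]
    have h1t : 0 < 1 + t := by linarith
    have hlog := sub_sq_le_log_one_add htl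
    have hsq : t ^ 2 ≤ w ^ 2 * spread a ^ 2 := by
      rw [ht, mul_pow]
      exact mul_le_mul_of_nonneg_left (sq_le_sq' (by linarith) (by linarith)) (sq_nonneg w)
    rw [hst, ← div_div, Real.log_div (div_pos (hπpos i) (hpos i)).ne' h1t.ne']
    have := mul_le_mul_of_nonneg_left (hlog) (hπpos i).le
    have := mul_le_mul_of_nonneg_left (hsq) (hπpos i).le
    have h5 : π i * t = w * (π i * (a i / mix a u) - π i) := by rw [ht]; ring
    nlinarith
  refine (Finset.sum_le_sum fun i _ => key i).trans (le_of_eq ?_)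
  rw [Finset.sum_add_distrib, Finset.sum_sub_distrib, ← Finset.mul_sum, Finset.sum_sub_distrib,
    ← mix_div_mix_eq, ← Finset.sum_mul, hπ.2, one_mul]
  rfl

/-- Divergence dominates squared Hellinger distance: log z ≥ 1 - 1/z at z = √π_i/√u_i gives π_i
log(π_i/u_i) ≥ 2π_i - 2√π_i√u_i, and adding u_i - π_i, which sums to 0, completes the square. -/
lemma sum_sq_sqrt_sub_le_kl (hπ : π ∈ stdSimplex ℝ ι) (hπpos : ∀ i, 0 < π i)
    (hu : u ∈ stdSimplex ℝ ι) (hpos : ∀ i, 0 < u i) :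
    ∑ i, (√(π i) - √(u i)) ^ 2 ≤ kl π u := by
  have h1 : ∀ i, (√(π i) - √(u i)) ^ 2 ≤ π i * Real.log (π i / u i) + (u i - π i) := fun i => by
    have hp := Real.sqrt_pos.2 (hπpos i)
    have hq := Real.sqrt_pos.2 (hpos i)
    have e1 := Real.sq_sqrt (hπpos i).le
    have e2 := Real.sq_sqrt (hpos i).le
    have h2 := Real.one_sub_inv_le_log_of_pos (div_pos hp hq)
    have h3 : Real.log (π i / u i) = 2 * Real.log (√(π i) / √(u i)) := by
      rw [← Real.sqrt_div (hπpos i).le, Real.log_sqrt (div_pos (hπpos i) (hpos i)).le]; ring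
    rw [inv_div] at h2
    have h4 := mul_le_mul_of_nonneg_left h2 (mul_pos two_pos (hπpos i)).le
    have h5 : 2 * π i * (1 - √(u i) / √(π i)) = 2 * π i - 2 * √(π i) * √(u i) := by
      have : π i * (√(u i) / √(π i)) = √(π i) * √(u i) := by
        nth_rewrite 1 [← e1]; field_simp
      linear_combination -2 * this
    rw [h3]
    nlinarith
  calc _ ≤ ∑ i, (π i * Real.log (π i / u i) + (u i - π i)) := Finset.sum_le_sum fun i _ => h1 i
    _ = kl π u := by
      rw [Finset.sum_add_distrib, Finset.sum_sub_distrib, hu.2, hπ.2, sub_self, add_zero]; rfl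

lemma kl_nonneg (hπ : π ∈ stdSimplex ℝ ι) (hπpos : ∀ i, 0 < π i)
    (hu : u ∈ stdSimplex ℝ ι) (hpos : ∀ i, 0 < u i) : 0 ≤ kl π u :=
  (Finset.sum_nonneg fun _ _ => sq_nonneg _).trans (sum_sq_sqrt_sub_le_kl hπ hπpos hu hpos)

lemma continuousAt_kl (hπpos : ∀ i, 0 < π i) : ContinuousAt (kl π) π := by
  refine tendsto_finsetSum _ fun i _ => Tendsto.const_mul _ ?_
  refine Tendsto.log ?_ (div_pos (hπpos i) (hπpos i)).ne'
  exact Tendsto.div tendsto_const_nhds ((continuous_apply i).tendsto π) (hπpos i).ne'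

lemma kl_self : kl π π = 0 := by
  refine Finset.sum_eq_zero fun i _ => ?_
  rcases eq_or_ne (π i) 0 with h | h <;> simp [h]

lemma tendsto_of_kl_tendsto_zero {y : ℕ → ι → ℝ} (hπ : π ∈ stdSimplex ℝ ι)
    (hπpos : ∀ i, 0 < π i) (hy : ∀ n, y n ∈ stdSimplex ℝ ι) (hpos : ∀ n i, 0 < y n i)
    (h : Tendsto (fun n => kl π (y n)) atTop (𝓝 0)) : Tendsto y atTop (𝓝 π) := by
  rw [tendsto_pi_nhds]
  intro i
  have h1 : Tendsto (fun n => (√(π i) - √(y n i)) ^ 2) atTop (𝓝 0) :=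
    squeeze_zero (fun _ => sq_nonneg _) (fun n =>
      (Finset.single_le_sum (f := fun i => (√(π i) - √(y n i)) ^ 2) (fun _ _ => sq_nonneg _)
        (Finset.mem_univ i)).trans (sum_sq_sqrt_sub_le_kl hπ hπpos (hy n) (hpos n))) h
  have h2 : Tendsto (fun n => √(π i) - √(y n i)) atTop (𝓝 0) := by
    have := (Real.continuous_sqrt.tendsto 0).comp h1
    simp only [Real.sqrt_zero, Function.comp_def, Real.sqrt_sq_eq_abs] at this
    exact tendsto_zero_iff_abs_tendsto_zero _ |>.2 this
  have h3 : Tendsto (fun n => (√(π i) - (√(π i) - √(y n i))) ^ 2) atTop (𝓝 ((√(π i) - 0) ^ 2)) :=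
    (tendsto_const_nhds.sub h2).pow 2
  simp only [sub_sub_cancel, sub_zero, Real.sq_sqrt (hπpos i).le] at h3
  simpa only [Real.sq_sqrt (hpos _ i).le] using h3

end Finite

/-! ### Block boundaries and deterministic convergence lemmas. -/

section Deterministic

/-- Up to rounding, the terms are exp(-c j^δ) with c = -log ρ > 0, which decays faster than any
power of j; comparison with j⁻² suffices. -/
lemma summable_pow_ceil_rpow {ρ δ : ℝ} (hρ0 : 0 < ρ) (hρ1 : ρ < 1) (hδ : 0 < δ) :
    Summable fun j : ℕ => ρ ^ (⌈(j : ℝ) ^ δ⌉₊ + 1) := by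
  have h1 : (fun j : ℕ => ρ ^ (⌈(j : ℝ) ^ δ⌉₊ + 1)) =O[atTop] fun j : ℕ => (j : ℝ) ^ (-2 : ℝ) := by
    have h2 := isLittleO_exp_neg_mul_rpow_atTop (neg_pos.2 (Real.log_neg hρ0 hρ1)) (-2 / δ)
    have h3 : Tendsto (fun j : ℕ => (j : ℝ) ^ δ) atTop atTop :=
      (tendsto_rpow_atTop hδ).comp tendsto_natCast_atTop_atTop
    have h4 := (h2.comp_tendsto h3).isBigO
    refine (Asymptotics.IsBigO.of_bound 1 (Eventually.of_forall fun j => ?_)).trans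
      (h4.congr_right fun j => ?_)
    · simp only [Function.comp_apply, neg_neg, one_mul, Real.norm_eq_abs, Real.abs_exp]
      rw [abs_of_pos (pow_pos hρ0 _), ← Real.rpow_natCast, Real.rpow_def_of_pos hρ0]
      refine Real.exp_le_exp.2 (mul_le_mul_of_nonpos_left ?_ (Real.log_neg hρ0 hρ1).le)
      push_cast
      linarith [Nat.le_ceil ((j : ℝ) ^ δ)]
    · simp only [Function.comp_apply]
      rw [← Real.rpow_mul (Nat.cast_nonneg j), mul_div_cancel₀ _ hδ.ne']
  exact summable_of_isBigO_nat (Real.summable_nat_rpow.2 (by norm_num)) h1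

lemma sum_sum_Ioc_eq {t : ℕ → ℕ} (ht : Monotone t) (w : ℕ → ℝ) (n : ℕ) :
    ∑ j ∈ Finset.range n, ∑ i ∈ Finset.Ioc (t j) (t (j + 1)), w i
      = ∑ i ∈ Finset.Ioc (t 0) (t n), w i := by
  induction n with
  | zero => simp
  | succ n ih =>
    rw [Finset.sum_range_succ, ih, Finset.sum_Ioc_consecutive _ (ht (Nat.zero_le n))
      (ht (Nat.le_succ n))]

/-- Block boundaries along which the squared block weights are summable, although the blocks are
long enough for `ρ ^ length` to be summable. -/
lemma exists_block_boundaries {w : ℕ → ℝ} {α ρ : ℝ} (hw : ∀ i, 1 ≤ i → 0 < w i)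
    (hw0 : Tendsto w atTop (𝓝 0)) (hα : 1 / 2 < α) (hα1 : α ≤ 1)
    (hΘ : Asymptotics.IsTheta atTop w (fun i : ℕ => (i : ℝ) ^ (-α)))
    (hρ0 : 0 < ρ) (hρ1 : ρ < 1) :
    ∃ t : ℕ → ℕ, StrictMono t ∧ 1 ≤ t 0 ∧ (∀ i, t 0 < i → w i ≤ 1 / 4) ∧
      (Summable fun j => (∑ i ∈ Finset.Ioc (t j) (t (j + 1)), w i) ^ 2) ∧
      (Summable fun j => ρ ^ (t (j + 1) - t j)) ∧
      ¬ Summable fun j => ∑ i ∈ Finset.Ioc (t j) (t (j + 1)), w i := by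
  obtain ⟨c, hc, hcb⟩ := hΘ.1.exists_pos
  obtain ⟨T, hT⟩ := eventually_atTop.1
    ((hw0.eventually (eventually_le_nhds (by norm_num : (0 : ℝ) < 1 / 4))).and
      (hcb.bound.and (eventually_ge_atTop 1)))
  -- Blocks of length about j^δ have weight O(j^(δ - α)), since t j ≥ j + 1. This δ makes 2(δ - α) =
  -- -α - 1/2, which is below -1 exactly because α > 1/2.
  set δ : ℝ := (2 * α - 1) / 4 with hδ
  have hδ0 : 0 < δ := by rw [hδ]; linarith
  let ℓ : ℕ → ℕ := fun j => ⌈(j : ℝ) ^ δ⌉₊ + 1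
  let t : ℕ → ℕ := fun j => T + ∑ i ∈ Finset.range j, ℓ i
  have htsucc : ∀ j, t (j + 1) = t j + ℓ j := fun j => by
    simp only [t, Finset.sum_range_succ, add_assoc]
  have hmono : StrictMono t := strictMono_nat_of_lt_succ fun j => by
    rw [htsucc]; exact Nat.lt_add_of_pos_right (Nat.succ_pos _)
  have ht0 : t 0 = T := by simp [t]
  have hT1 : 1 ≤ T := (hT T le_rfl).2.2
  have htj : ∀ j, j + 1 ≤ t j := fun j => by
    induction j with
    | zero => simpa [ht0] using hT1
    | succ j ih => have : t j < t (j + 1) := hmono (Nat.lt_succ_self j); omega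
  refine ⟨t, hmono, by omega, fun i hi => (hT i (by omega)).1, ?_, ?_, ?_⟩
  · have hb : ∀ j, ∑ i ∈ Finset.Ioc (t j) (t (j + 1)), w i
        ≤ 3 * c * ((j : ℝ) + 1) ^ (δ - α) := fun j => by
      have hj1 : (0 : ℝ) < (j : ℝ) + 1 := by positivity
      have h1 : ∀ i ∈ Finset.Ioc (t j) (t (j + 1)), w i ≤ c * ((j : ℝ) + 1) ^ (-α) := fun i hi => by
        have hi1 := (Finset.mem_Ioc.1 hi).1
        have hTi : T ≤ i := by
          have := hmono.monotone (Nat.zero_le j); omega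
        have h2 := (hT i hTi).2.1
        rw [Real.norm_eq_abs, Real.norm_eq_abs,
          abs_of_nonneg (Real.rpow_nonneg (Nat.cast_nonneg i) _)] at h2
        refine (le_abs_self _).trans (h2.trans (mul_le_mul_of_nonneg_left ?_ hc.le))
        refine Real.rpow_le_rpow_of_nonpos hj1 ?_ (by linarith)
        have := htj j
        exact_mod_cast (by omega : j + 1 ≤ i)
      have h2 : ((ℓ j : ℕ) : ℝ) ≤ 3 * ((j : ℝ) + 1) ^ δ := by
        have h3 := (Nat.ceil_lt_add_one (Real.rpow_nonneg (Nat.cast_nonneg j) δ)).le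
        have h4 : (j : ℝ) ^ δ ≤ ((j : ℝ) + 1) ^ δ :=
          Real.rpow_le_rpow (Nat.cast_nonneg j) (by linarith) hδ0.le
        have h5 : 1 ≤ ((j : ℝ) + 1) ^ δ :=
          Real.one_le_rpow (by linarith [(Nat.cast_nonneg j : (0 : ℝ) ≤ j)]) hδ0.le
        simp only [ℓ]; push_cast; linarith
      calc _ ≤ (Finset.Ioc (t j) (t (j + 1))).card • (c * ((j : ℝ) + 1) ^ (-α)) :=
            Finset.sum_le_card_nsmul _ _ _ h1
        _ = (ℓ j : ℝ) * (c * ((j : ℝ) + 1) ^ (-α)) := by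
            rw [Nat.card_Ioc, htsucc, Nat.add_sub_cancel_left, nsmul_eq_mul]
        _ ≤ (3 * ((j : ℝ) + 1) ^ δ) * (c * ((j : ℝ) + 1) ^ (-α)) :=
            mul_le_mul_of_nonneg_right h2 (mul_nonneg hc.le (Real.rpow_nonneg hj1.le _))
        _ = _ := by rw [sub_eq_add_neg, Real.rpow_add hj1]; ring
    have hs : Summable fun j : ℕ => 9 * c ^ 2 * ((j : ℝ) + 1) ^ (2 * (δ - α)) := by
      have := (summable_nat_add_iff 1).2 (Real.summable_nat_rpow.2
        (by rw [hδ]; linarith : 2 * (δ - α) < -1))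
      refine Summable.mul_left _ (by simpa using this)
    refine Summable.of_nonneg_of_le (fun _ => sq_nonneg _) (fun j => ?_) hs
    have h0 : 0 ≤ ∑ i ∈ Finset.Ioc (t j) (t (j + 1)), w i :=
      Finset.sum_nonneg fun i hi => (hw i (by have := Finset.mem_Ioc.1 hi; omega)).le
    refine (pow_le_pow_left₀ h0 (hb j) 2).trans (le_of_eq ?_)
    rw [mul_pow, ← Real.rpow_natCast (((j : ℝ) + 1) ^ (δ - α)), ← Real.rpow_mul (by positivity)]
    push_cast
    ring_nf
  · simpa only [htsucc, Nat.add_sub_cancel_left, ℓ] using summable_pow_ceil_rpow hρ0 hρ1 hδ0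
  · intro hs
    have hW0 : ∀ j, 0 ≤ ∑ i ∈ Finset.Ioc (t j) (t (j + 1)), w i := fun j =>
      Finset.sum_nonneg fun i hi => (hw i (by have := Finset.mem_Ioc.1 hi; omega)).le
    have hsum : Summable fun i => w (i + (t 0 + 1)) := by
      refine summable_of_sum_range_le (c := ∑' j, ∑ i ∈ Finset.Ioc (t j) (t (j + 1)), w i)
        (fun i => (hw _ (by omega)).le) fun n => ?_
      refine le_trans ?_ (hs.sum_le_tsum (Finset.range n) fun j _ => hW0 j)
      rw [sum_sum_Ioc_eq hmono.monotone]
      have h1 : ∑ i ∈ Finset.range n, w (i + (t 0 + 1)) = ∑ i ∈ Finset.Ioc (t 0) (t 0 + n), w i := by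
        rw [Finset.range_eq_Ico, Finset.sum_Ico_add' w 0 n (t 0 + 1)]
        refine Finset.sum_congr (Finset.ext fun i => ?_) fun _ _ => rfl
        simp only [Finset.mem_Ico, Finset.mem_Ioc]; omega
      rw [h1]
      refine Finset.sum_le_sum_of_subset_of_nonneg (Finset.Ioc_subset_Ioc_right ?_)
        fun i hi _ => (hw i (by have := Finset.mem_Ioc.1 hi; omega)).le
      clear h1
      induction n with
      | zero => simp
      | succ n ih => have : t n < t (n + 1) := hmono (Nat.lt_succ_self n); omega
    -- The lower half of the exact order would make i^(-α) summable, contradicting α ≤ 1.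
    have := summable_of_isBigO_nat ((summable_nat_add_iff _).1 hsum) hΘ.2
    have := Real.summable_nat_rpow.1 this
    linarith

/-- An almost decreasing nonnegative sequence converges, and the drift is small infinitely often if
the step sizes are not summable. -/
lemma tendsto_and_frequently_lt_of_le {A c g ξ : ℕ → ℝ} (hA : ∀ j, 0 ≤ A j) (hc : ∀ j, 0 ≤ c j)
    (hg : ∀ j, 0 ≤ g j) (h : ∀ j, A (j + 1) ≤ A j - c j * g j + ξ j)
    (hξ : ∃ l, Tendsto (fun n => ∑ j ∈ Finset.range n, ξ j) atTop (𝓝 l)) (hcs : ¬ Summable c) :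
    (∃ L, Tendsto A atTop (𝓝 L)) ∧ ∀ ε > 0, ∃ᶠ j in atTop, g j < ε := by
  obtain ⟨l, hl⟩ := hξ
  obtain ⟨B, hB⟩ := hl.bddAbove_range
  have hB' : ∀ n, ∑ j ∈ Finset.range n, ξ j ≤ B := fun n => hB ⟨n, rfl⟩
  -- Subtracting the perturbations leaves a decreasing sequence, bounded below because their partial
  -- sums are bounded above.
  have hanti : Antitone fun n => A n - ∑ j ∈ Finset.range n, ξ j := antitone_nat_of_succ_le fun n => by
    rw [Finset.sum_range_succ]
    linarith [h n, mul_nonneg (hc n) (hg n)]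
  have hlim := tendsto_atTop_ciInf hanti ⟨-B, by
    rintro _ ⟨n, rfl⟩; linarith [hA n, hB' n]⟩
  refine ⟨⟨_, (hlim.add hl).congr fun n => by ring⟩, fun ε hε => ?_⟩
  by_contra hcon
  rw [not_frequently] at hcon
  obtain ⟨N, hN⟩ := eventually_atTop.1 hcon
  refine hcs ((summable_nat_add_iff N).1 ?_)
  have hsum : ∀ n, A n + ∑ j ∈ Finset.range n, c j * g j ≤ A 0 + ∑ j ∈ Finset.range n, ξ j := by
    intro n
    induction n with
    | zero => simp
    | succ n ih => rw [Finset.sum_range_succ, Finset.sum_range_succ]; linarith [h n]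
  have h1 : Summable fun j => c j * g j :=
    summable_of_sum_range_le (c := A 0 + B) (fun j => mul_nonneg (hc j) (hg j))
      fun n => by linarith [hsum n, hA n, hB' n]
  have h2 := ((summable_nat_add_iff N).2 h1).mul_left ε⁻¹
  refine Summable.of_nonneg_of_le (fun j => hc _) (fun j => ?_) h2
  have := hN (j + N) (by omega)
  rw [not_lt] at this
  rw [inv_mul_eq_div, le_div_iff₀ hε]
  exact mul_le_mul_of_nonneg_left this (hc _)

/-- A sequence whose steps are at most `2 * w` converges if it does so along block boundaries whose
block weights tend to `0`. -/
lemma tendsto_of_tendsto_comp_of_sum_tendsto_zero {ι : Type*} [Fintype ι] {y : ℕ → ι → ℝ}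
    {π : ι → ℝ} {w : ℕ → ℝ} {t : ℕ → ℕ} (ht : StrictMono t) (hw : ∀ i, 1 ≤ i → 0 ≤ w i)
    (hy : ∀ m n, m ≤ n → ∑ i, |y n i - y m i| ≤ 2 * ∑ j ∈ Finset.Ioc m n, w j)
    (hW : Tendsto (fun j => ∑ i ∈ Finset.Ioc (t j) (t (j + 1)), w i) atTop (𝓝 0))
    (h : Tendsto (fun j => y (t j)) atTop (𝓝 π)) : Tendsto y atTop (𝓝 π) := by
  rw [tendsto_pi_nhds] at h ⊢
  intro i
  rw [Metric.tendsto_atTop]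
  intro ε hε
  obtain ⟨N, hN⟩ := eventually_atTop.1
    (((h i).eventually (Metric.ball_mem_nhds _ (half_pos hε))).and
      (hW.eventually (gt_mem_nhds (by positivity : 0 < ε / 4))))
  refine ⟨t N, fun n hn => ?_⟩
  -- The block containing n: its right end is the first boundary beyond n.
  obtain ⟨j, hj1, hj2⟩ : ∃ j, t j ≤ n ∧ n < t (j + 1) := by
    have hex : ∃ k, n < t k := ⟨n + 1, lt_of_lt_of_le (Nat.lt_succ_self n) ht.le_apply⟩
    have hk := Nat.find_spec hex
    have hk0 : Nat.find hex ≠ 0 := fun h0 => by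
      rw [h0] at hk
      have := ht.monotone (Nat.zero_le N)
      omega
    refine ⟨Nat.find hex - 1, not_lt.1 (Nat.find_min hex (by omega)), ?_⟩
    rwa [Nat.sub_add_cancel (by omega)]
  have hNj : N ≤ j := by
    have := ht.lt_iff_lt.1 (lt_of_le_of_lt hn hj2)
    omega
  obtain ⟨h1, h2⟩ := hN j hNj
  have h3 : |y n i - y (t j) i| ≤ 2 * ∑ i ∈ Finset.Ioc (t j) (t (j + 1)), w i :=
    ((Finset.single_le_sum (f := fun i => |y n i - y (t j) i|) (fun _ _ => abs_nonneg _)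
      (Finset.mem_univ i)).trans (hy _ _ hj1)).trans
      (mul_le_mul_of_nonneg_left (Finset.sum_le_sum_of_subset_of_nonneg
        (Finset.Ioc_subset_Ioc_right hj2.le) fun k hk _ => hw k
          (by have := Finset.mem_Ioc.1 hk; omega)) zero_le_two)
  have h4 := dist_triangle (y n i) (y (t j) i) (π i)
  rw [Real.dist_eq (y n i) (y (t j) i)] at h4
  have h5 : dist (y (t j) i) (π i) < ε / 2 := h1
  linarith

end Deterministic

/-! ### Square-integrable martingale tools. -/

section Probability

variable {Ω : Type*} {m0 : MeasurableSpace Ω} {P : Measure Ω}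

/-- By Tonelli the sum has finite expectation, hence is finite almost surely. -/
lemma ae_summable_of_summable_integral {F : ℕ → Ω → ℝ} {c : ℕ → ℝ}
    (hF : ∀ k, Integrable (F k) P) (hF0 : ∀ k, 0 ≤ᵐ[P] F k) (hc : ∀ k, ∫ ω, F k ω ∂P ≤ c k)
    (hs : Summable c) : ∀ᵐ ω ∂P, Summable fun k => F k ω := by
  have h1 : ∫⁻ ω, ∑' k, ENNReal.ofReal (F k ω) ∂P ≠ ∞ := by
    rw [lintegral_tsum fun k => (hF k).aemeasurable.ennreal_ofReal]
    have h2 : ∀ k, ∫⁻ ω, ENNReal.ofReal (F k ω) ∂P ≤ ENNReal.ofReal (c k) := fun k => by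
      rw [← ofReal_integral_eq_lintegral_ofReal (hF k) (hF0 k)]
      exact ENNReal.ofReal_le_ofReal (hc k)
    exact ne_top_of_le_ne_top hs.tsum_ofReal_ne_top (ENNReal.tsum_le_tsum h2)
  filter_upwards [ae_lt_top' (AEMeasurable.tsum fun k =>
    (hF k).aemeasurable.ennreal_ofReal) h1, ae_all_iff.2 hF0] with ω hω hω0
  refine (ENNReal.summable_toReal hω.ne).congr fun k => ?_
  rw [ENNReal.toReal_ofReal (hω0 k)]

variable [IsProbabilityMeasure P]

lemma integral_mul_sub_condExp_eq_zero {m : MeasurableSpace Ω} (hm : m ≤ m0) {Y D : Ω → ℝ}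
    (hY : StronglyMeasurable[m] Y) (hY2 : MemLp Y 2 P) (hD : MemLp D 2 P) :
    ∫ ω, Y ω * (D ω - P[D | m] ω) ∂P = 0 := by
  have hYD : Integrable (Y * D) P := hY2.integrable_mul hD
  have hC : MemLp (P[D | m]) 2 P := hD.condExp (by norm_num)
  have h1 := condExp_mul_of_stronglyMeasurable_left hY hYD (hD.integrable (by norm_num))
  have h2 : ∫ ω, (Y * D) ω ∂P = ∫ ω, (Y * P[D | m]) ω ∂P := by
    rw [← integral_condExp hm]
    exact integral_congr_ae h1
  simp only [mul_sub]
  exact (integral_sub hYD (hY2.integrable_mul hC)).trans (sub_eq_zero.2 h2)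

/-- Pythagoras: conditional expectation is an orthogonal projection in L². Both contractions below
are read off from it. -/
lemma integral_sq_eq_add_condExp {m : MeasurableSpace Ω} (hm : m ≤ m0) {D : Ω → ℝ}
    (hD : MemLp D 2 P) : ∫ ω, D ω ^ 2 ∂P
      = ∫ ω, P[D | m] ω ^ 2 ∂P + ∫ ω, (D ω - P[D | m] ω) ^ 2 ∂P := by
  have hC : MemLp (P[D | m]) 2 P := hD.condExp (by norm_num)
  have h0 := integral_mul_sub_condExp_eq_zero hm stronglyMeasurable_condExp hC hD
  have h1 : ∀ ω, D ω ^ 2 = P[D | m] ω ^ 2 + (D ω - P[D | m] ω) ^ 2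
      + 2 * (P[D | m] ω * (D ω - P[D | m] ω)) := fun ω => by ring
  rw [integral_congr_ae (Eventually.of_forall h1), integral_add, integral_add, integral_const_mul,
    h0, mul_zero, add_zero]
  · exact hC.integrable_sq
  · exact (hD.sub hC).integrable_sq
  · exact hC.integrable_sq.add (hD.sub hC).integrable_sq
  · exact (hC.integrable_mul (hD.sub hC)).const_mul 2

lemma integral_condExp_sq_le {m : MeasurableSpace Ω} (hm : m ≤ m0) {D : Ω → ℝ}
    (hD : MemLp D 2 P) : ∫ ω, P[D | m] ω ^ 2 ∂P ≤ ∫ ω, D ω ^ 2 ∂P := by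
  rw [integral_sq_eq_add_condExp hm hD]
  exact le_add_of_nonneg_right (integral_nonneg fun _ => sq_nonneg _)

lemma integral_sub_condExp_sq_le {m : MeasurableSpace Ω} (hm : m ≤ m0) {D : Ω → ℝ}
    (hD : MemLp D 2 P) : ∫ ω, (D ω - P[D | m] ω) ^ 2 ∂P ≤ ∫ ω, D ω ^ 2 ∂P := by
  rw [integral_sq_eq_add_condExp hm hD]
  exact le_add_of_nonneg_left (integral_nonneg fun _ => sq_nonneg _)

/-- A sum of centered variables with summable second moments converges almost surely. -/
lemma ae_exists_tendsto_sum_sub_condExp (𝒢 : Filtration ℕ m0) {D : ℕ → Ω → ℝ} {c : ℕ → ℝ}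
    (hD : ∀ k, StronglyMeasurable[𝒢 (k + 1)] (D k)) (hL : ∀ k, MemLp (D k) 2 P)
    (hs : Summable c) (hc : ∀ k, ∫ ω, D k ω ^ 2 ∂P ≤ c k) :
    ∀ᵐ ω ∂P, ∃ l, Tendsto (fun n => ∑ k ∈ Finset.range n, (D k ω - P[D k | 𝒢 k] ω))
      atTop (𝓝 l) := by
  let M : ℕ → Ω → ℝ := fun n => ∑ k ∈ Finset.range n, (D k - P[D k | 𝒢 k])
  have hMs : ∀ n, M (n + 1) = M n + (D n - P[D n | 𝒢 n]) := fun n => Finset.sum_range_succ _ _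
  have hM : ∀ n, StronglyMeasurable[𝒢 n] (M n) := fun n =>
    Finset.stronglyMeasurable_sum _ fun k hk =>
      ((hD k).mono (𝒢.mono (Finset.mem_range.1 hk))).sub
        (stronglyMeasurable_condExp.mono (𝒢.mono (Finset.mem_range.1 hk).le))
  have hdL : ∀ k, MemLp (D k - P[D k | 𝒢 k]) 2 P := fun k => (hL k).sub ((hL k).condExp (by norm_num))
  have hML : ∀ n, MemLp (M n) 2 P := fun n => memLp_finsetSum' _ fun k _ => hdL k
  have hMi : ∀ n, Integrable (M n) P := fun n => (hML n).integrable (by norm_num)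
  have hmart : Martingale M 𝒢 P := by
    refine martingale_nat hM hMi fun n => ?_
    rw [hMs]
    have hDi := (hL n).integrable (by norm_num)
    refine ((condExp_add (hMi n) ((hdL n).integrable (by norm_num)) (𝒢 n)).trans ?_).symm
    have h1 := condExp_sub hDi (integrable_condExp (m := 𝒢 n) (f := D n)) (𝒢 n)
    filter_upwards [h1] with ω hω
    rw [Pi.add_apply, hω, Pi.sub_apply,
      condExp_of_stronglyMeasurable (𝒢.le n) (hM n) (hMi n),
      condExp_of_stronglyMeasurable (𝒢.le n) stronglyMeasurable_condExp integrable_condExp]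
    simp
  -- Martingale increments are orthogonal to the past, so second moments add up.
  have hsq : ∀ n, ∫ ω, M n ω ^ 2 ∂P ≤ ∑ k ∈ Finset.range n, c k := by
    intro n
    induction n with
    | zero => simp [M]
    | succ n ih =>
      have h1 : ∀ ω, M (n + 1) ω ^ 2 = M n ω ^ 2 + (D n ω - P[D n | 𝒢 n] ω) ^ 2
          + 2 * (M n ω * (D n ω - P[D n | 𝒢 n] ω)) := fun ω => by
        rw [hMs]; simp only [Pi.add_apply, Pi.sub_apply]; ring
      rw [integral_congr_ae (Eventually.of_forall h1), integral_add, integral_add,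
        integral_const_mul, integral_mul_sub_condExp_eq_zero (𝒢.le n) (hM n) (hML n) (hL n),
        mul_zero, add_zero, Finset.sum_range_succ]
      · exact add_le_add ih ((integral_sub_condExp_sq_le (𝒢.le n) (hL n)).trans (hc n))
      · exact (hML n).integrable_sq
      · exact (hdL n).integrable_sq
      · exact (hML n).integrable_sq.add (hdL n).integrable_sq
      · exact ((hML n).integrable_mul (hdL n)).const_mul 2
  have hc0 : ∀ k, 0 ≤ c k := fun k => (integral_nonneg fun _ => sq_nonneg _).trans (hc k)
  -- The convergence theorem asks for an L¹ bound; |M| ≤ 1 + M² derives it from the L² bound.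
  have hbdd : ∀ n, eLpNorm (M n) 1 P ≤ (Real.toNNReal (1 + ∑' k, c k) : ℝ≥0∞) := fun n => by
    rw [eLpNorm_one_eq_lintegral_enorm, ← ofReal_integral_norm_eq_lintegral_enorm (hMi n)]
    refine ENNReal.ofReal_le_ofReal ?_
    calc ∫ ω, ‖M n ω‖ ∂P ≤ ∫ ω, (1 + M n ω ^ 2) ∂P := by
          refine integral_mono (hMi n).norm ((integrable_const 1).add (hML n).integrable_sq)
            fun ω => ?_
          simp only [Real.norm_eq_abs]
          nlinarith [sq_abs (M n ω), sq_nonneg (|M n ω| - 1), abs_nonneg (M n ω)]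
      _ = 1 + ∫ ω, M n ω ^ 2 ∂P := by
          rw [integral_add (integrable_const 1) (hML n).integrable_sq]; simp
      _ ≤ _ := by
          gcongr
          exact (hsq n).trans (hs.sum_le_tsum _ fun k _ => hc0 k)
  filter_upwards [hmart.submartingale.exists_ae_tendsto_of_bdd hbdd] with ω hω
  simpa only [M, Finset.sum_apply, Pi.sub_apply] using hω

/-- Duality between L¹ and L^∞: the extremal test function is the sign of the conditional
expectation. It turns correlation bounds against the past into an L¹ bound on the conditional mean.
-/
lemma integral_abs_condExp_le_of_forall {m : MeasurableSpace Ω} (hm : m ≤ m0) {Z : Ω → ℝ}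
    (hZ : Integrable Z P) {c : ℝ}
    (h : ∀ g : Ω → ℝ, Measurable[m] g → (∀ ω, |g ω| ≤ 1) → ∫ ω, g ω * Z ω ∂P ≤ c) :
    ∫ ω, |P[Z | m] ω| ∂P ≤ c := by
  have hC : Measurable[m] (P[Z | m]) := stronglyMeasurable_condExp.measurable
  set g : Ω → ℝ := fun ω => if 0 ≤ P[Z | m] ω then 1 else -1 with hg
  have hgm : Measurable[m] g :=
    Measurable.ite (measurableSet_le measurable_const hC) measurable_const measurable_const
  have hg1 : ∀ ω, |g ω| ≤ 1 := fun ω => by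
    simp only [hg]; split_ifs <;> simp
  have hgZ : Integrable (g * Z) P :=
    hZ.bdd_mul (hgm.mono hm le_rfl).aestronglyMeasurable (Eventually.of_forall hg1)
  have h1 := condExp_mul_of_stronglyMeasurable_left hgm.stronglyMeasurable hgZ hZ
  refine le_trans (le_of_eq ?_) (h g hgm hg1)
  calc ∫ ω, |P[Z | m] ω| ∂P = ∫ ω, P[g * Z | m] ω ∂P := by
        refine integral_congr_ae ?_
        filter_upwards [h1] with ω hω
        rw [hω]
        simp only [hg, Pi.mul_apply]
        split_ifs with h0
        · rw [abs_of_nonneg h0, one_mul]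
        · rw [abs_of_neg (not_le.1 h0)]; ring
    _ = _ := integral_condExp hm

end Probability

/-! ### The drift: positivity, vanishing only at the truth, continuity. -/

section Drift

variable {ι χ : Type*} [Fintype ι]

/-- The mixture ratio `mix a π / mix a v`, truncated so that it is bounded by `spread a` even for
degenerate arguments. -/
noncomputable def mixRatio (π a v : ι → ℝ) : ℝ := min |mix a π / mix a v| (spread a)

/-- The mean of the mixture ratio when the data have law `L`. -/
noncomputable def meanRatio [MeasurableSpace χ] (L : Measure χ) (K : χ → ι → ℝ) (π v : ι → ℝ) : ℝ :=
  ∫ x, mixRatio π (K x) v ∂L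

variable {π a u v : ι → ℝ}

lemma mixRatio_nonneg (ha : ∀ i, 0 ≤ a i) : 0 ≤ mixRatio π a v :=
  le_min (abs_nonneg _) (spread_nonneg ha)

lemma mixRatio_le : mixRatio π a v ≤ spread a := min_le_right _ _

lemma mixRatio_eq (ha : ∀ i, 0 < a i) (hπ : π ∈ stdSimplex ℝ ι) (hv : v ∈ stdSimplex ℝ ι) :
    mixRatio π a v = mix a π / mix a v := by
  rw [mixRatio, abs_of_nonneg (mix_div_mix_nonneg ha hπ hv), min_eq_left (mix_div_mix_le ha hπ hv)]

lemma measurable_mix : Measurable fun z : (ι → ℝ) × (ι → ℝ) => mix z.1 z.2 := by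
  unfold mix; fun_prop

lemma measurable_spread : Measurable (spread : (ι → ℝ) → ℝ) := by
  unfold spread; fun_prop

lemma measurable_mixRatio (π : ι → ℝ) :
    Measurable fun z : (ι → ℝ) × (ι → ℝ) => mixRatio π z.1 z.2 := by
  have h1 : Measurable fun z : (ι → ℝ) × (ι → ℝ) => mix z.1 π :=
    measurable_mix.comp (measurable_fst.prodMk measurable_const)
  have h2 : Measurable fun z : (ι → ℝ) × (ι → ℝ) => |mix z.1 π / mix z.1 z.2| :=
    (h1.div measurable_mix).abs
  exact h2.min (measurable_spread.comp measurable_fst)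

lemma measurable_step (w : ℝ) : Measurable fun z : (ι → ℝ) × (ι → ℝ) => step w z.1 z.2 := by
  refine measurable_pi_lambda _ fun i => ?_
  have := measurable_mix (ι := ι)
  unfold step
  fun_prop

variable [MeasurableSpace χ] {L : Measure χ} {K : χ → ι → ℝ}

lemma meanRatio_nonneg (hK0 : ∀ x i, 0 ≤ K x i) : 0 ≤ meanRatio L K π v :=
  integral_nonneg fun x => mixRatio_nonneg (hK0 x)

variable [IsProbabilityMeasure L]

lemma measurable_meanRatio (hK : Measurable K) : Measurable (meanRatio L K π) := by
  have : StronglyMeasurable (Function.uncurry fun (v : ι → ℝ) (x : χ) => mixRatio π (K x) v) :=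
    ((measurable_mixRatio π).comp
      ((hK.comp measurable_snd).prodMk measurable_fst)).stronglyMeasurable
  exact (this.integral_prod_right (ν := L)).measurable

lemma integrable_mixRatio (hK : Measurable K) (hK0 : ∀ x i, 0 ≤ K x i)
    (hR : MemLp (fun x => spread (K x)) 2 L) (v : ι → ℝ) :
    Integrable (fun x => mixRatio π (K x) v) L := by
  refine (hR.integrable (by norm_num)).mono'
    ((measurable_mixRatio π).comp (hK.prodMk measurable_const)).aestronglyMeasurable
    (Eventually.of_forall fun x => ?_)
  rw [Real.norm_eq_abs, abs_of_nonneg (mixRatio_nonneg (hK0 x))]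
  exact mixRatio_le

lemma meanRatio_le (hK : Measurable K) (hK0 : ∀ x i, 0 ≤ K x i)
    (hR : MemLp (fun x => spread (K x)) 2 L) :
    meanRatio L K π v ≤ ∫ x, spread (K x) ∂L :=
  integral_mono (integrable_mixRatio hK hK0 hR v) (hR.integrable (by norm_num))
    fun _ => mixRatio_le

/-- The map is Lipschitz at each point in ℓ¹ distance, with constant the second moment of `spread`.
-/
lemma continuousOn_meanRatio (hK : Measurable K) (hK0 : ∀ x i, 0 ≤ K x i)
    (hKpos : ∀ᵐ x ∂L, ∀ i, 0 < K x i) (hR : MemLp (fun x => spread (K x)) 2 L)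
    (hπ : π ∈ stdSimplex ℝ ι) : ContinuousOn (meanRatio L K π) (stdSimplex ℝ ι) := by
  intro v hv
  have hb : ∀ u ∈ stdSimplex ℝ ι, dist (meanRatio L K π u) (meanRatio L K π v)
      ≤ (∫ x, spread (K x) ^ 2 ∂L) * ∑ i, |u i - v i| := fun u hu => by
    rw [Real.dist_eq, meanRatio, meanRatio, ← integral_sub (integrable_mixRatio hK hK0 hR u)
      (integrable_mixRatio hK hK0 hR v), ← integral_mul_const]
    refine (abs_integral_le_integral_abs).trans (integral_mono_ae
      ((integrable_mixRatio hK hK0 hR u).sub (integrable_mixRatio hK hK0 hR v)).abs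
      (hR.integrable_sq.mul_const _) ?_)
    filter_upwards [hKpos] with x hx
    simp only [mixRatio_eq hx hπ hu, mixRatio_eq hx hπ hv]
    exact abs_mix_div_mix_sub_le hx hπ hu hv
  rw [ContinuousWithinAt, tendsto_iff_dist_tendsto_zero]
  have h0 : Tendsto (fun u : ι → ℝ => (∫ x, spread (K x) ^ 2 ∂L) * ∑ i, |u i - v i|)
      (𝓝[stdSimplex ℝ ι] v) (𝓝 0) := by
    have : Continuous fun u : ι → ℝ => (∫ x, spread (K x) ^ 2 ∂L) * ∑ i, |u i - v i| := by
      fun_prop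
    have h := this.tendsto v
    simp only [sub_self, abs_zero, Finset.sum_const_zero, mul_zero] at h
    exact h.mono_left nhdsWithin_le_nhds
  refine squeeze_zero' (Eventually.of_forall fun _ => dist_nonneg) ?_ h0
  filter_upwards [self_mem_nhdsWithin] with u hu using hb u hu

lemma integrable_mix_div_mix (hK : Measurable K) (hKpos : ∀ᵐ x ∂L, ∀ i, 0 < K x i)
    (hR : MemLp (fun x => spread (K x)) 2 L) (hu : u ∈ stdSimplex ℝ ι)
    (hv : v ∈ stdSimplex ℝ ι) : Integrable (fun x => mix (K x) u / mix (K x) v) L := by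
  refine (hR.integrable (by norm_num)).mono' ?_ ?_
  · exact ((measurable_mix.comp (hK.prodMk measurable_const)).div
      (measurable_mix.comp (hK.prodMk measurable_const))).aestronglyMeasurable
  · filter_upwards [hKpos] with x hx
    rw [Real.norm_eq_abs, abs_of_nonneg (mix_div_mix_nonneg hx hu hv)]
    exact mix_div_mix_le hx hu hv

/-- With r = m_π/m_v the integrand is r + 1/r - 2 ≥ 0, and `hdiv` says that 1/r has mean at most 1.
Thus the drift dominates the mean of a nonnegative function that vanishes only where m_v = m_π. -/
lemma integral_mixRatio_add_le (hK : Measurable K) (hK0 : ∀ x i, 0 ≤ K x i)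
    (hKpos : ∀ᵐ x ∂L, ∀ i, 0 < K x i) (hR : MemLp (fun x => spread (K x)) 2 L)
    (hπ : π ∈ stdSimplex ℝ ι) (hv : v ∈ stdSimplex ℝ ι)
    (hdiv : ∫ x, mix (K x) v / mix (K x) π ∂L ≤ 1) :
    ∫ x, (mixRatio π (K x) v + mix (K x) v / mix (K x) π - 2) ∂L ≤ meanRatio L K π v - 1 := by
  have h1 := integrable_mixRatio (π := π) hK hK0 hR v
  have h2 := integrable_mix_div_mix hK hKpos hR hv hπ
  have h3 : ∫ x, (mixRatio π (K x) v + mix (K x) v / mix (K x) π - 2) ∂L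
      = meanRatio L K π v + ∫ x, mix (K x) v / mix (K x) π ∂L - 2 := by
    refine (integral_sub (h1.add h2) (integrable_const (2 : ℝ))).trans ?_
    rw [integral_add' h1 h2]
    simp [meanRatio]
  linarith

lemma mixRatio_add_eq (ha : ∀ i, 0 < a i) (hπ : π ∈ stdSimplex ℝ ι) (hv : v ∈ stdSimplex ℝ ι) :
    mixRatio π a v + mix a v / mix a π - 2 = (mix a v - mix a π) ^ 2 / (mix a v * mix a π) := by
  have h1 := (mix_pos ha hπ).ne'
  have h2 := (mix_pos ha hv).ne'
  rw [mixRatio_eq ha hπ hv]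
  field_simp
  ring

lemma mixRatio_add_nonneg (ha : ∀ i, 0 < a i) (hπ : π ∈ stdSimplex ℝ ι)
    (hv : v ∈ stdSimplex ℝ ι) : 0 ≤ mixRatio π a v + mix a v / mix a π - 2 := by
  rw [mixRatio_add_eq ha hπ hv]
  exact div_nonneg (sq_nonneg _) (mul_nonneg (mix_pos ha hv).le (mix_pos ha hπ).le)

lemma one_le_meanRatio (hK : Measurable K) (hK0 : ∀ x i, 0 ≤ K x i)
    (hKpos : ∀ᵐ x ∂L, ∀ i, 0 < K x i) (hR : MemLp (fun x => spread (K x)) 2 L)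
    (hπ : π ∈ stdSimplex ℝ ι) (hv : v ∈ stdSimplex ℝ ι)
    (hdiv : ∫ x, mix (K x) v / mix (K x) π ∂L ≤ 1) : 0 ≤ meanRatio L K π v - 1 := by
  refine le_trans (integral_nonneg_of_ae ?_) (integral_mixRatio_add_le hK hK0 hKpos hR hπ hv hdiv)
  filter_upwards [hKpos] with x hx using mixRatio_add_nonneg hx hπ hv

lemma mix_ae_eq_of_meanRatio_le (hK : Measurable K) (hK0 : ∀ x i, 0 ≤ K x i)
    (hKpos : ∀ᵐ x ∂L, ∀ i, 0 < K x i) (hR : MemLp (fun x => spread (K x)) 2 L)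
    (hπ : π ∈ stdSimplex ℝ ι) (hv : v ∈ stdSimplex ℝ ι)
    (hdiv : ∫ x, mix (K x) v / mix (K x) π ∂L ≤ 1) (h : meanRatio L K π v - 1 ≤ 0) :
    (fun x => mix (K x) v) =ᵐ[L] fun x => mix (K x) π := by
  have h0 : 0 ≤ᵐ[L] fun x => mixRatio π (K x) v + mix (K x) v / mix (K x) π - 2 := by
    filter_upwards [hKpos] with x hx using mixRatio_add_nonneg hx hπ hv
  have hi : Integrable (fun x => mixRatio π (K x) v + mix (K x) v / mix (K x) π - 2) L :=
    ((integrable_mixRatio hK hK0 hR v).add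
      (integrable_mix_div_mix hK hKpos hR hv hπ)).sub (integrable_const _)
  have h1 := (integral_eq_zero_iff_of_nonneg_ae h0 hi).1 (le_antisymm
    ((integral_mixRatio_add_le hK hK0 hKpos hR hπ hv hdiv).trans h) (integral_nonneg_of_ae h0))
  filter_upwards [h1, hKpos] with x hx hpos
  rw [mixRatio_add_eq hpos hπ hv, Pi.zero_apply, div_eq_zero_iff] at hx
  rcases hx with hx | hx
  · exact sub_eq_zero.1 (pow_eq_zero_iff two_ne_zero |>.1 hx)
  · exact absurd hx (mul_pos (mix_pos hpos hv) (mix_pos hpos hπ)).ne'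

/-- If the drift is small infinitely often and the divergence converges, it converges to `0`. -/
lemma kl_tendsto_zero_of_frequently (hK : Measurable K) (hK0 : ∀ x i, 0 ≤ K x i)
    (hKpos : ∀ᵐ x ∂L, ∀ i, 0 < K x i) (hR : MemLp (fun x => spread (K x)) 2 L)
    (hπ : π ∈ stdSimplex ℝ ι) (hπpos : ∀ i, 0 < π i)
    (hdiv : ∀ v ∈ stdSimplex ℝ ι, ∫ x, mix (K x) v / mix (K x) π ∂L ≤ 1)
    (hid : ∀ v ∈ stdSimplex ℝ ι, ((fun x => mix (K x) v) =ᵐ[L] fun x => mix (K x) π) → v = π)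
    {y : ℕ → ι → ℝ} (hy : ∀ n, y n ∈ stdSimplex ℝ ι) (hpos : ∀ n i, 0 < y n i) {l : ℝ}
    (hl : Tendsto (fun n => kl π (y n)) atTop (𝓝 l))
    (hf : ∀ ε > 0, ∃ᶠ n in atTop, meanRatio L K π (y n) - 1 < ε) : l = 0 := by
  have hl0 : 0 ≤ l := ge_of_tendsto' hl fun n => kl_nonneg hπ hπpos (hy n) (hpos n)
  by_contra hne
  have hlpos : 0 < l := lt_of_le_of_ne hl0 (Ne.symm hne)
  have hnhds : ∀ᶠ v in 𝓝 π, kl π v < l / 2 := by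
    have := continuousAt_kl hπpos
    rw [ContinuousAt, kl_self] at this
    exact this.eventually (gt_mem_nhds (half_pos hlpos))
  obtain ⟨V, hV, hVo, hπV⟩ := eventually_nhds_iff.1 hnhds
  -- Away from a neighbourhood V of π where the divergence is below l/2, the continuous drift
  -- attains a positive minimum. A small drift therefore forces the weights into V, where the
  -- divergence is too small to be near l.
  have hcomp : IsCompact (stdSimplex ℝ ι \ V) := (isCompact_stdSimplex ℝ ι).diff hVo
  obtain ⟨ε, hε, hmin⟩ : ∃ ε > 0, ∀ v ∈ stdSimplex ℝ ι \ V, ε ≤ meanRatio L K π v - 1 := by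
    rcases (stdSimplex ℝ ι \ V).eq_empty_or_nonempty with he | hne'
    · exact ⟨1, one_pos, fun v hv => by simp [he] at hv⟩
    · obtain ⟨v, hv, hvmin⟩ := hcomp.exists_isMinOn hne'
        (((continuousOn_meanRatio hK hK0 hKpos hR hπ).mono Set.sdiff_subset).sub continuousOn_const)
      refine ⟨meanRatio L K π v - 1, ?_, fun u hu => hvmin hu⟩
      by_contra hle
      have := hid v hv.1 (mix_ae_eq_of_meanRatio_le hK hK0 hKpos hR hπ hv.1 (hdiv v hv.1)
        (not_lt.1 hle))
      exact hv.2 (this ▸ hπV)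
  obtain ⟨n, h1, h2⟩ := ((hf ε hε).and_eventually
    (hl.eventually (lt_mem_nhds (half_lt_self hlpos)))).exists
  have : y n ∈ V := by
    by_contra hn
    exact absurd (hmin (y n) ⟨hy n, hn⟩) (not_le.2 h1)
  exact lt_asymm h2 (hV _ this)

end Drift

/-! ### Filtrations generated by initial segments of the data. -/

section Past

variable {Ω χ : Type*} {mΩ : MeasurableSpace Ω} [MeasurableSpace χ] {X : ℕ → Ω → χ}

lemma measurable_past (hX : ∀ i, 1 ≤ i → Measurable (X i)) (s : ℕ) : Measurable (past X s) :=
  measurable_pi_lambda _ fun _ => hX _ (Nat.succ_pos _)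

/-- The filtration generated by the initial segments of the data. -/
def pastFiltration (hX : ∀ i, 1 ≤ i → Measurable (X i)) : Filtration ℕ mΩ where
  seq s := MeasurableSpace.comap (past X s) inferInstance
  mono' s t hst := by
    have h : past X s = (fun (y : Fin t → χ) (k : Fin s) => y (Fin.castLE hst k)) ∘ past X t := rfl
    change MeasurableSpace.comap (past X s) _ ≤ MeasurableSpace.comap (past X t) _
    rw [h, ← MeasurableSpace.comap_comp]
    refine MeasurableSpace.comap_mono ?_
    exact Measurable.comap_le (measurable_pi_lambda _ fun k => measurable_pi_apply _)
  le' s := (measurable_past hX s).comap_le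

lemma measurable_pastFiltration (hX : ∀ i, 1 ≤ i → Measurable (X i)) {i s : ℕ} (hi : 1 ≤ i)
    (his : i ≤ s) : Measurable[pastFiltration hX s] (X i) := by
  -- Coordinate k of `past` holds observation k + 1, hence the shift.
  have h : X i = (fun y : Fin s → χ => y ⟨i - 1, by omega⟩) ∘ past X s := by
    ext ω
    simp only [past, Function.comp_apply, Nat.sub_add_cancel hi]
  rw [h]
  exact (measurable_pi_apply _).comp (comap_measurable (past X s))

/-- Subsampling a filtration along a monotone sequence of times. -/
def subFiltration (𝒢 : Filtration ℕ mΩ) {t : ℕ → ℕ} (ht : Monotone t) : Filtration ℕ mΩ where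
  seq j := 𝒢 (t j)
  mono' _ _ h := 𝒢.mono (ht h)
  le' j := 𝒢.le (t j)

end Past

/-! ### Noise with a delayed anchor and almost sure convergence of its block sums. -/

section Noise

variable {Ω χ ι : Type*} [Fintype ι] {mΩ : MeasurableSpace Ω} [MeasurableSpace χ]
  {P : Measure Ω} {L : Measure χ} {X : ℕ → Ω → χ} {K : χ → ι → ℝ} {π : ι → ℝ}
  {U : ℕ → Ω → ι → ℝ} {w : ℕ → ℝ}

/-- The deviation of the mixture ratio at `X i`, anchored at the weights at time `s`, from its mean. -/
noncomputable def noise (L : Measure χ) (K : χ → ι → ℝ) (π : ι → ℝ) (X : ℕ → Ω → χ)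
    (U : ℕ → Ω → ι → ℝ) (s i : ℕ) (ω : Ω) : ℝ :=
  mixRatio π (K (X i ω)) (U s ω) - meanRatio L K π (U s ω)

lemma measurable_recursion (hK : Measurable K) (hX : ∀ i, 1 ≤ i → Measurable (X i)) {u₀ : ι → ℝ}
    (hU0 : ∀ ω, U 0 ω = u₀)
    (hU : ∀ n ω, U (n + 1) ω = step (w (n + 1)) (K (X (n + 1) ω)) (U n ω)) (n : ℕ) :
    Measurable[pastFiltration hX n] (U n) := by
  induction n with
  | zero =>
    rw [funext hU0]
    exact measurable_const
  | succ n ih =>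
    rw [funext (hU n)]
    have h1 : Measurable[pastFiltration hX (n + 1)] fun ω => K (X (n + 1) ω) :=
      hK.comp (measurable_pastFiltration hX (Nat.succ_pos n) le_rfl)
    have h2 : Measurable[pastFiltration hX (n + 1)] (U n) :=
      ih.mono ((pastFiltration hX).mono (Nat.le_succ n)) le_rfl
    exact (measurable_step (w (n + 1))).comp (h1.prodMk h2)

lemma memLp_spread_comp (hX : ∀ i, 1 ≤ i → Measurable (X i))
    (hmap : ∀ i, 1 ≤ i → P.map (X i) = L) (hR : MemLp (fun x => spread (K x)) 2 L) {i : ℕ}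
    (hi : 1 ≤ i) : MemLp (fun ω => spread (K (X i ω))) 2 P := by
  rw [← hmap i hi] at hR
  exact hR.comp_of_map (hX i hi).aemeasurable

lemma integral_spread_comp_sq (hK : Measurable K) (hX : ∀ i, 1 ≤ i → Measurable (X i))
    (hmap : ∀ i, 1 ≤ i → P.map (X i) = L) {i : ℕ} (hi : 1 ≤ i) :
    ∫ ω, spread (K (X i ω)) ^ 2 ∂P = ∫ x, spread (K x) ^ 2 ∂L := by
  rw [← hmap i hi, integral_map (hX i hi).aemeasurable]
  exact ((measurable_spread.comp hK).pow_const 2).aestronglyMeasurable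

variable [IsProbabilityMeasure L]

lemma measurable_noise (hK : Measurable K) (hX : ∀ i, 1 ≤ i → Measurable (X i))
    (hUm : ∀ n, Measurable[pastFiltration hX n] (U n)) {s i : ℕ} (hi : 1 ≤ i) (his : s ≤ i) :
    Measurable[pastFiltration hX i] (noise L K π X U s i) := by
  have h1 : Measurable[pastFiltration hX i] fun ω => K (X i ω) :=
    hK.comp (measurable_pastFiltration hX hi le_rfl)
  have h2 : Measurable[pastFiltration hX i] (U s) :=
    (hUm s).mono ((pastFiltration hX).mono his) le_rfl
  exact ((measurable_mixRatio π).comp (h1.prodMk h2)).sub ((measurable_meanRatio hK).comp h2)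

variable [IsProbabilityMeasure P]

/-- The bound does not involve the weights, so moments of the noise are controlled by the marginal
law alone, whatever the dependence between anchor and data. -/
lemma abs_noise_le (hK : Measurable K) (hK0 : ∀ x i, 0 ≤ K x i)
    (hR : MemLp (fun x => spread (K x)) 2 L) (s i : ℕ) (ω : Ω) :
    |noise L K π X U s i ω| ≤ spread (K (X i ω)) + ∫ x, spread (K x) ∂L := by
  have h1 := mixRatio_nonneg (π := π) (v := U s ω) (hK0 (X i ω))
  have h2 := mixRatio_le (π := π) (a := K (X i ω)) (v := U s ω)
  have h3 := meanRatio_nonneg (L := L) (π := π) (v := U s ω) hK0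
  have h4 := meanRatio_le (π := π) (v := U s ω) hK hK0 hR
  rw [abs_le]
  constructor <;> simp only [noise] <;> linarith

lemma memLp_noise (hK : Measurable K) (hK0 : ∀ x i, 0 ≤ K x i)
    (hR : MemLp (fun x => spread (K x)) 2 L) (hX : ∀ i, 1 ≤ i → Measurable (X i))
    (hmap : ∀ i, 1 ≤ i → P.map (X i) = L)
    (hUm : ∀ n, Measurable[pastFiltration hX n] (U n)) {s i : ℕ} (hi : 1 ≤ i) (his : s ≤ i) :
    MemLp (noise L K π X U s i) 2 P := by
  refine ((memLp_spread_comp hX hmap hR hi).add (memLp_const (∫ x, spread (K x) ∂L))).mono'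
    ((measurable_noise hK hX hUm hi his).mono ((pastFiltration hX).le i) le_rfl).aestronglyMeasurable
    (Eventually.of_forall fun ω => ?_)
  exact abs_noise_le hK hK0 hR s i ω

lemma integral_noise_sq_le (hK : Measurable K) (hK0 : ∀ x i, 0 ≤ K x i)
    (hR : MemLp (fun x => spread (K x)) 2 L) (hX : ∀ i, 1 ≤ i → Measurable (X i))
    (hmap : ∀ i, 1 ≤ i → P.map (X i) = L)
    (hUm : ∀ n, Measurable[pastFiltration hX n] (U n)) {s i : ℕ} (hi : 1 ≤ i) (his : s ≤ i) :
    ∫ ω, noise L K π X U s i ω ^ 2 ∂P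
      ≤ 2 * ∫ x, spread (K x) ^ 2 ∂L + 2 * (∫ x, spread (K x) ∂L) ^ 2 := by
  have h1 := (memLp_spread_comp hX hmap hR hi).integrable_sq
  calc _ ≤ ∫ ω, (2 * spread (K (X i ω)) ^ 2 + 2 * (∫ x, spread (K x) ∂L) ^ 2) ∂P := by
        refine integral_mono (memLp_noise hK hK0 hR hX hmap hUm hi his).integrable_sq
          ((h1.const_mul 2).add (integrable_const _)) fun ω => ?_
        have h2 := abs_noise_le (π := π) (X := X) (U := U) hK hK0 hR s i ω
        have h3 := sq_le_sq' (by linarith [abs_nonneg (noise L K π X U s i ω)]) h2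
        rw [sq_abs] at h3
        refine h3.trans ?_
        nlinarith [sq_nonneg (spread (K (X i ω)) - ∫ x, spread (K x) ∂L)]
    _ = _ := by
        rw [integral_add (h1.const_mul 2) (integrable_const _), integral_const_mul,
          integral_spread_comp_sq hK hX hmap hi]
        simp

variable {C ρ : ℝ}

/-- Correlations of the noise with functions of the past decay with the distance in time. -/
lemma integral_mul_noise_le (hK : Measurable K) (hK0 : ∀ x i, 0 ≤ K x i)
    (hR : MemLp (fun x => spread (K x)) 2 L) (hX : ∀ i, 1 ≤ i → Measurable (X i))
    (hmap : ∀ i, 1 ≤ i → P.map (X i) = L)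
    (hUm : ∀ n, Measurable[pastFiltration hX n] (U n))
    (hdep : ∀ s n, 1 ≤ s → 1 ≤ n → ∀ Φ : (Fin s → χ) → χ → ℝ, Measurable (Function.uncurry Φ) →
      (∀ y x, |Φ y x| ≤ spread (K x)) →
      ∫ ω, Φ (past X s ω) (X (s + n) ω) ∂P - ∫ ω, ∫ x, Φ (past X s ω) x ∂L ∂P ≤ C * ρ ^ n)
    {s n : ℕ} (hs : 1 ≤ s) (hn : 1 ≤ n) {g : Ω → ℝ} (hg : Measurable[pastFiltration hX s] g)
    (hg1 : ∀ ω, |g ω| ≤ 1) :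
    ∫ ω, g ω * noise L K π X U s (s + n) ω ∂P ≤ C * ρ ^ n := by
  have hgU : Measurable[pastFiltration hX s] fun ω => (g ω, U s ω) := hg.prodMk (hUm s)
  -- Doob–Dynkin: the test function and the anchor are jointly a measurable function of the initial
  -- segment, so their product with the ratio has the form required by `hdep`.
  obtain ⟨h, hh, hgh⟩ := Measurable.exists_eq_measurable_comp
    (mY := MeasurableSpace.pi) (f := past X s) hgU
  have hg' : ∀ ω, (h (past X s ω)).1 = g ω := fun ω => (congrArg Prod.fst (congrFun hgh ω)).symm
  have hU' : ∀ ω, (h (past X s ω)).2 = U s ω := fun ω => (congrArg Prod.snd (congrFun hgh ω)).symm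
  -- The factor h is controlled only on the range of `past X s`; clamping to [-1, 1] makes the bound
  -- hold at every y and changes nothing on that range.
  let Φ : (Fin s → χ) → χ → ℝ := fun y x => max (-1) (min 1 (h y).1) * mixRatio π (K x) (h y).2
  have hΦm : Measurable (Function.uncurry Φ) := by
    refine Measurable.mul ?_ ((measurable_mixRatio π).comp
      ((hK.comp measurable_snd).prodMk (measurable_snd.comp (hh.comp measurable_fst))))
    exact measurable_const.max (measurable_const.min (measurable_fst.comp (hh.comp measurable_fst)))
  have hΦb : ∀ y x, |Φ y x| ≤ spread (K x) := fun y x => by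
    have h1 : |max (-1) (min 1 (h y).1)| ≤ 1 :=
      abs_le.2 ⟨le_max_left _ _, max_le (by norm_num) (min_le_left _ _)⟩
    rw [abs_mul, abs_of_nonneg (mixRatio_nonneg (hK0 x))]
    exact (mul_le_of_le_one_left (mixRatio_nonneg (hK0 x)) h1).trans mixRatio_le
  have hclamp : ∀ ω, max (-1) (min 1 (h (past X s ω)).1) = g ω := fun ω => by
    have := abs_le.1 (hg1 ω)
    rw [hg', min_eq_right this.2, max_eq_right this.1]
  have hΦ1 : ∀ ω, Φ (past X s ω) (X (s + n) ω) = g ω * mixRatio π (K (X (s + n) ω)) (U s ω) :=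
    fun ω => by simp only [Φ]; rw [hclamp, hU']
  have hΦ2 : ∀ ω, ∫ x, Φ (past X s ω) x ∂L = g ω * meanRatio L K π (U s ω) := fun ω => by
    simp only [Φ, integral_const_mul]; rw [hclamp, hU']; rfl
  refine le_trans (le_of_eq ?_) (hdep s n hs hn Φ hΦm hΦb)
  simp only [hΦ1, hΦ2]
  have hgm := hg.mono ((pastFiltration hX).le s) le_rfl
  have hUm' := (hUm s).mono ((pastFiltration hX).le s) le_rfl
  rw [← integral_sub]
  · simp only [noise, mul_sub]
  · refine Integrable.bdd_mul (c := 1) ?_ hgm.aestronglyMeasurable (Eventually.of_forall hg1)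
    refine ((memLp_spread_comp hX hmap hR (by omega : 1 ≤ s + n)).integrable (by norm_num)).mono'
      ((measurable_mixRatio π).comp
        ((hK.comp (hX _ (by omega))).prodMk hUm')).aestronglyMeasurable
      (Eventually.of_forall fun ω => ?_)
    rw [Real.norm_eq_abs, abs_of_nonneg (mixRatio_nonneg (hK0 _))]
    exact mixRatio_le
  · refine Integrable.bdd_mul (c := 1) ?_ hgm.aestronglyMeasurable (Eventually.of_forall hg1)
    refine (integrable_const (∫ x, spread (K x) ∂L)).mono'
      ((measurable_meanRatio hK).comp hUm').aestronglyMeasurable (Eventually.of_forall fun ω => ?_)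
    rw [Real.norm_eq_abs, abs_of_nonneg (meanRatio_nonneg hK0)]
    exact meanRatio_le hK hK0 hR

/-- The noise accumulated over the block after the next one, anchored at the current time. -/
noncomputable def blockNoise (L : Measure χ) (K : χ → ι → ℝ) (π : ι → ℝ) (X : ℕ → Ω → χ)
    (U : ℕ → Ω → ι → ℝ) (w : ℕ → ℝ) (t : ℕ → ℕ) (j : ℕ) (ω : Ω) : ℝ :=
  ∑ i ∈ Finset.Ioc (t (j + 1)) (t (j + 1 + 1)), w i * noise L K π X U (t j) i ω

/-- The total weight of a block. -/
noncomputable def blockWeight (w : ℕ → ℝ) (t : ℕ → ℕ) (j : ℕ) : ℝ :=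
  ∑ i ∈ Finset.Ioc (t j) (t (j + 1)), w i

lemma blockWeight_nonneg (hw : ∀ i, 1 ≤ i → 0 ≤ w i) (t : ℕ → ℕ) (j : ℕ) :
    0 ≤ blockWeight w t j :=
  Finset.sum_nonneg fun i hi => hw i (by have := Finset.mem_Ioc.1 hi; omega)

/-- The accumulated noise converges almost surely. -/
lemma ae_exists_tendsto_sum_blockNoise (hK : Measurable K) (hK0 : ∀ x i, 0 ≤ K x i)
    (hR : MemLp (fun x => spread (K x)) 2 L) (hX : ∀ i, 1 ≤ i → Measurable (X i))
    (hmap : ∀ i, 1 ≤ i → P.map (X i) = L)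
    (hUm : ∀ n, Measurable[pastFiltration hX n] (U n))
    (hρ0 : 0 < ρ) (hρ1 : ρ < 1) (hC : 0 ≤ C)
    (hdep : ∀ s n, 1 ≤ s → 1 ≤ n → ∀ Φ : (Fin s → χ) → χ → ℝ, Measurable (Function.uncurry Φ) →
      (∀ y x, |Φ y x| ≤ spread (K x)) →
      ∫ ω, Φ (past X s ω) (X (s + n) ω) ∂P - ∫ ω, ∫ x, Φ (past X s ω) x ∂L ∂P ≤ C * ρ ^ n)
    (hw : ∀ i, 1 ≤ i → 0 ≤ w i) {t : ℕ → ℕ} (ht : StrictMono t) (ht0 : 1 ≤ t 0)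
    (hW2 : Summable fun j => blockWeight w t j ^ 2)
    (hρs : Summable fun j => ρ ^ (t (j + 1) - t j)) :
    ∀ᵐ ω ∂P, ∃ l, Tendsto (fun n => ∑ j ∈ Finset.range n, blockNoise L K π X U w t j ω)
      atTop (𝓝 l) := by
  set D := blockNoise L K π X U w t with hDdef
  set 𝓕 := pastFiltration hX
  have ht1 : ∀ j, 1 ≤ t j := fun j => ht0.trans (ht.monotone (Nat.zero_le j))
  have hlt : ∀ j, t j < t (j + 1) := fun j => ht (Nat.lt_succ_self j)
  have hmem : ∀ {j i}, i ∈ Finset.Ioc (t (j + 1)) (t (j + 1 + 1)) → 1 ≤ i ∧ t j ≤ i := fun {j i} hi => by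
    have := Finset.mem_Ioc.1 hi
    have := ht1 (j + 1)
    have := hlt j
    omega
  have hDm : ∀ j, StronglyMeasurable[𝓕 (t (j + 1 + 1))] (D j) := fun j => by
    refine Measurable.stronglyMeasurable ?_
    refine Finset.measurable_sum _ fun i hi => Measurable.const_mul ?_ _
    exact (measurable_noise hK hX hUm (hmem hi).1 (hmem hi).2).mono
      (𝓕.mono (Finset.mem_Ioc.1 hi).2) le_rfl
  have hZL : ∀ {j i}, i ∈ Finset.Ioc (t (j + 1)) (t (j + 1 + 1)) →
      MemLp (noise L K π X U (t j) i) 2 P := fun hi =>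
    memLp_noise hK hK0 hR hX hmap hUm (hmem hi).1 (hmem hi).2
  have hDL : ∀ j, MemLp (D j) 2 P := fun j =>
    memLp_finsetSum _ fun i hi => (hZL hi).const_mul (w i)
  have hDi : ∀ j, Integrable (D j) P := fun j => (hDL j).integrable (by norm_num)
  set M := 2 * ∫ x, spread (K x) ^ 2 ∂L + 2 * (∫ x, spread (K x) ∂L) ^ 2 with hM
  -- Cauchy–Schwarz weighted by w; no orthogonality within a block is needed, because squared block
  -- weights are already summable.
  have hDsq : ∀ j, ∫ ω, D j ω ^ 2 ∂P ≤ M * blockWeight w t (j + 1) ^ 2 := fun j => by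
    have hw' : ∀ i ∈ Finset.Ioc (t (j + 1)) (t (j + 1 + 1)), 0 ≤ w i := fun i hi =>
      hw i (hmem hi).1
    calc ∫ ω, D j ω ^ 2 ∂P
        ≤ ∫ ω, blockWeight w t (j + 1) * ∑ i ∈ Finset.Ioc (t (j + 1)) (t (j + 1 + 1)),
            w i * noise L K π X U (t j) i ω ^ 2 ∂P := by
          refine integral_mono (hDL j).integrable_sq ((integrable_finsetSum _ fun i hi =>
            (hZL hi).integrable_sq.const_mul (w i)).const_mul _) fun ω => ?_
          exact Finset.sum_sq_le_sum_mul_sum_of_sq_le_mul _ hw'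
            (fun i hi => mul_nonneg (hw' i hi) (sq_nonneg _)) fun i _ => le_of_eq (by ring)
      _ = blockWeight w t (j + 1) * ∑ i ∈ Finset.Ioc (t (j + 1)) (t (j + 1 + 1)),
            w i * ∫ ω, noise L K π X U (t j) i ω ^ 2 ∂P := by
          rw [integral_const_mul, integral_finsetSum _ fun i hi =>
            (hZL hi).integrable_sq.const_mul (w i)]
          simp only [integral_const_mul]
      _ ≤ blockWeight w t (j + 1) * ∑ i ∈ Finset.Ioc (t (j + 1)) (t (j + 1 + 1)), w i * M := by
          refine mul_le_mul_of_nonneg_left (Finset.sum_le_sum fun i hi =>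
            mul_le_mul_of_nonneg_left ?_ (hw' i hi)) (blockWeight_nonneg hw t _)
          exact integral_noise_sq_le hK hK0 hR hX hmap hUm (hmem hi).1 (hmem hi).2
      _ = _ := by rw [← Finset.sum_mul, ← blockWeight]; ring
  have hMs : Summable fun j => M * blockWeight w t (j + 1) ^ 2 :=
    ((summable_nat_add_iff 1).2 hW2).mul_left M
  have ht' : Monotone fun j => t (j + 1) := fun a b hab => ht.monotone (Nat.succ_le_succ hab)
  -- `D j` is measurable at time t (j + 2) but its mean is controlled only given time t j, two
  -- blocks back. Centering is therefore done in two stages, each along a filtration that advances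
  -- one block at a time.
  have hpart1 := ae_exists_tendsto_sum_sub_condExp (subFiltration 𝓕 ht') (D := D)
    hDm hDL hMs hDsq
  have hpart2 := ae_exists_tendsto_sum_sub_condExp (subFiltration 𝓕 ht.monotone)
    (D := fun j => P[D j | 𝓕 (t (j + 1))]) (fun j => stronglyMeasurable_condExp)
    (fun j => (hDL j).condExp (by norm_num)) hMs
    fun j => (integral_condExp_sq_le (𝓕.le _) (hDL j)).trans (hDsq j)
  -- Every observation in the block lies at distance more than t (j + 1) - t j from the anchor, so
  -- decay gives C · W · ρ^(gap) with W the block weight. The product is split as W² + ρ^(gap),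
  -- using ρ^(2 gap) ≤ ρ^(gap).
  have hcond : ∀ j, ∫ ω, |P[D j | 𝓕 (t j)] ω| ∂P
      ≤ C * (blockWeight w t (j + 1) ^ 2 + ρ ^ (t (j + 1) - t j)) := fun j => by
    refine integral_abs_condExp_le_of_forall (𝓕.le _) (hDi j) fun g hg hg1 => ?_
    have hgm := hg.mono (𝓕.le (t j)) le_rfl
    have hρn : 0 ≤ ρ ^ (t (j + 1) - t j) := (pow_pos hρ0 _).le
    have hgZ : ∀ i ∈ Finset.Ioc (t (j + 1)) (t (j + 1 + 1)),
        Integrable (fun ω => w i * (g ω * noise L K π X U (t j) i ω)) P := fun i hi =>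
      (Integrable.bdd_mul (c := 1) ((hZL hi).integrable (by norm_num)) hgm.aestronglyMeasurable
        (Eventually.of_forall hg1)).const_mul _
    calc ∫ ω, g ω * D j ω ∂P
        = ∑ i ∈ Finset.Ioc (t (j + 1)) (t (j + 1 + 1)),
            w i * ∫ ω, g ω * noise L K π X U (t j) i ω ∂P := by
          simp only [hDdef, blockNoise, Finset.mul_sum, mul_left_comm (g _)]
          rw [integral_finsetSum _ hgZ]
          simp only [integral_const_mul]
      _ ≤ ∑ i ∈ Finset.Ioc (t (j + 1)) (t (j + 1 + 1)), w i * (C * ρ ^ (t (j + 1) - t j)) := by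
          refine Finset.sum_le_sum fun i hi => mul_le_mul_of_nonneg_left ?_ (hw i (hmem hi).1)
          have h1 := Finset.mem_Ioc.1 hi
          have h2 := hlt j
          have h3 := integral_mul_noise_le (π := π) hK hK0 hR hX hmap hUm hdep (ht1 j)
            (by omega : 1 ≤ i - t j) hg hg1
          rw [Nat.add_sub_cancel' (hmem hi).2] at h3
          exact h3.trans (mul_le_mul_of_nonneg_left
            (pow_le_pow_of_le_one hρ0.le hρ1.le (by omega)) hC)
      _ = C * (blockWeight w t (j + 1) * ρ ^ (t (j + 1) - t j)) := by
          rw [← Finset.sum_mul, ← blockWeight]; ring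
      _ ≤ _ := by
          refine mul_le_mul_of_nonneg_left ?_ hC
          have h1 : ρ ^ (t (j + 1) - t j) ≤ 1 := pow_le_one₀ hρ0.le hρ1.le
          nlinarith [sq_nonneg (blockWeight w t (j + 1) - ρ ^ (t (j + 1) - t j)),
            sq_nonneg (blockWeight w t (j + 1))]
  have hpart3 := ae_summable_of_summable_integral (P := P)
    (F := fun j ω => |P[D j | 𝓕 (t j)] ω|) (fun j => integrable_condExp.abs)
    (fun j => Eventually.of_forall fun ω => abs_nonneg _) hcond
    ((((summable_nat_add_iff 1).2 hW2).add hρs).mul_left C)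
  -- The tower property makes the two centered parts and the remaining conditional mean telescope to
  -- `D j`.
  have htower : ∀ᵐ ω ∂P, ∀ j, P[P[D j | 𝓕 (t (j + 1))] | 𝓕 (t j)] ω = P[D j | 𝓕 (t j)] ω :=
    ae_all_iff.2 fun j => condExp_condExp_of_le (𝓕.mono (hlt j).le) (𝓕.le _)
  filter_upwards [hpart1, hpart2, hpart3, htower] with ω ⟨l₁, h₁⟩ ⟨l₂, h₂⟩ h₃ h₄
  refine ⟨_, ((h₁.add h₂).add h₃.of_abs.hasSum.tendsto_sum_nat).congr fun n => ?_⟩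
  rw [← Finset.sum_add_distrib, ← Finset.sum_add_distrib]
  refine Finset.sum_congr rfl fun j _ => ?_
  change D j ω - P[D j | 𝓕 (t (j + 1))] ω + (P[D j | 𝓕 (t (j + 1))] ω
    - P[P[D j | 𝓕 (t (j + 1))] | 𝓕 (t j)] ω) + P[D j | 𝓕 (t j)] ω = D j ω
  rw [h₄]
  ring

end Noise

/-! ### Pathwise descent of the divergence. -/

section Path

variable {ι : Type*} [Fintype ι] {a y : ℕ → ι → ℝ} {w : ℕ → ℝ} {π : ι → ℝ}

lemma recursion_mem_stdSimplex_and_pos (ha : ∀ i, 1 ≤ i → ∀ k, 0 < a i k)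
    (hw : ∀ i, 1 ≤ i → 0 < w i ∧ w i ≤ 1) (hy0 : y 0 ∈ stdSimplex ℝ ι) (hpos : ∀ k, 0 < y 0 k)
    (hy : ∀ n, y (n + 1) = step (w (n + 1)) (a (n + 1)) (y n)) (n : ℕ) :
    y n ∈ stdSimplex ℝ ι ∧ ∀ k, 0 < y n k := by
  induction n with
  | zero => exact ⟨hy0, hpos⟩
  | succ n ih =>
    have h1 := hw (n + 1) (Nat.succ_pos n)
    have h2 := ha (n + 1) (Nat.succ_pos n)
    rw [hy]
    exact ⟨step_mem_stdSimplex h2 h1.1.le h1.2 ih.1, step_pos h2 h1.1 h1.2 ih.1 ih.2⟩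

lemma sum_abs_recursion_sub_le (ha : ∀ i, 1 ≤ i → ∀ k, 0 < a i k)
    (hw : ∀ i, 1 ≤ i → 0 ≤ w i) (hs : ∀ n, y n ∈ stdSimplex ℝ ι)
    (hy : ∀ n, y (n + 1) = step (w (n + 1)) (a (n + 1)) (y n)) (m n : ℕ) (hmn : m ≤ n) :
    ∑ k, |y n k - y m k| ≤ 2 * ∑ i ∈ Finset.Ioc m n, w i := by
  induction n, hmn using Nat.le_induction with
  | base => simp
  | succ n hmn ih =>
    rw [Finset.sum_Ioc_succ_top hmn, mul_add]
    have h1 := sum_abs_step_sub_le (ha (n + 1) (Nat.succ_pos n)) (hw (n + 1) (Nat.succ_pos n)) (hs n)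
    rw [← hy] at h1
    calc ∑ k, |y (n + 1) k - y m k| ≤ ∑ k, (|y n k - y m k| + |y (n + 1) k - y n k|) :=
          Finset.sum_le_sum fun k _ => by linarith [abs_sub_le (y (n + 1) k) (y n k) (y m k)]
      _ ≤ _ := by rw [Finset.sum_add_distrib]; exact add_le_add ih h1

lemma kl_recursion_le (ha : ∀ i, 1 ≤ i → ∀ k, 0 < a i k) (hw : ∀ i, 1 ≤ i → 0 < w i)
    (hπ : π ∈ stdSimplex ℝ ι) (hπpos : ∀ k, 0 < π k)
    (hs : ∀ n, y n ∈ stdSimplex ℝ ι) (hpos : ∀ n k, 0 < y n k)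
    (hy : ∀ n, y (n + 1) = step (w (n + 1)) (a (n + 1)) (y n)) {m n : ℕ} (hmn : m ≤ n)
    (hw4 : ∀ i, m < i → w i ≤ 1 / 4) :
    kl π (y n) ≤ kl π (y m) + ∑ i ∈ Finset.Ioc m n,
      (-w i * (mix (a i) π / mix (a i) (y (i - 1)) - 1) + w i ^ 2 * spread (a i) ^ 2) := by
  induction n, hmn using Nat.le_induction with
  | base => simp
  | succ n hmn ih =>
    have h1 := kl_step_le (ha (n + 1) (Nat.succ_pos n)) (hw (n + 1) (Nat.succ_pos n))
      (hw4 (n + 1) (Nat.lt_succ_of_le hmn)) hπ hπpos (hs n) (hpos n)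
    rw [← hy] at h1
    rw [Finset.sum_Ioc_succ_top hmn, Nat.add_sub_cancel]
    linarith

/-- Over a block, the mixture ratios may be evaluated at an earlier anchor `y s`, up to an error of
second order in the weights since the anchor. -/
lemma kl_recursion_le_of_anchor (ha : ∀ i, 1 ≤ i → ∀ k, 0 < a i k) (hw : ∀ i, 1 ≤ i → 0 < w i)
    (hπ : π ∈ stdSimplex ℝ ι) (hπpos : ∀ k, 0 < π k)
    (hs : ∀ n, y n ∈ stdSimplex ℝ ι) (hpos : ∀ n k, 0 < y n k)
    (hy : ∀ n, y (n + 1) = step (w (n + 1)) (a (n + 1)) (y n)) {s m n : ℕ} (hsm : s ≤ m)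
    (hmn : m ≤ n) (hw4 : ∀ i, m < i → w i ≤ 1 / 4) :
    kl π (y n) ≤ kl π (y m) - ∑ i ∈ Finset.Ioc m n, w i * (mixRatio π (a i) (y s) - 1)
      + 3 * (∑ i ∈ Finset.Ioc s n, w i) * ∑ i ∈ Finset.Ioc m n, w i * spread (a i) ^ 2 := by
  refine (kl_recursion_le ha hw hπ hπpos hs hpos hy hmn hw4).trans ?_
  rw [sub_eq_add_neg, add_assoc]
  refine add_le_add le_rfl ?_
  rw [← Finset.sum_neg_distrib, Finset.mul_sum, ← Finset.sum_add_distrib]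
  refine Finset.sum_le_sum fun i hi => ?_
  obtain ⟨hmi, hin⟩ := Finset.mem_Ioc.1 hi
  have hi1 : 1 ≤ i := by omega
  have hwi := (hw i hi1).le
  have hwnn : ∀ j ∈ Finset.Ioc s n, 0 ≤ w j := fun j hj =>
    (hw j (by have := Finset.mem_Ioc.1 hj; omega)).le
  set S := ∑ j ∈ Finset.Ioc s n, w j
  -- The constant 3 collects 2 from the ℓ¹ displacement 2S since the anchor and 1 from the quadratic
  -- term, where w_i² ≤ w_i S.
  have h1 : w i ≤ S := Finset.single_le_sum hwnn (Finset.mem_Ioc.2 ⟨by omega, hin⟩)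
  have h2 : ∑ k, |y (i - 1) k - y s k| ≤ 2 * S :=
    (sum_abs_recursion_sub_le ha (fun i hi => (hw i hi).le) hs hy s (i - 1) (by omega)).trans
      (mul_le_mul_of_nonneg_left (Finset.sum_le_sum_of_subset_of_nonneg
        (Finset.Ioc_subset_Ioc_right (by omega)) fun j hj _ => hwnn j hj) zero_le_two)
  have h3 := (abs_le.1 (abs_mix_div_mix_sub_le (ha i hi1) hπ (hs (i - 1)) (hs s))).1
  rw [mixRatio_eq (ha i hi1) hπ (hs s)]
  have h4 : spread (a i) ^ 2 * ∑ k, |y (i - 1) k - y s k| ≤ spread (a i) ^ 2 * (2 * S) :=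
    mul_le_mul_of_nonneg_left h2 (sq_nonneg _)
  have h5 := mul_le_mul_of_nonneg_left (h4.trans' (by linarith :
    mix (a i) π / mix (a i) (y s) - mix (a i) π / mix (a i) (y (i - 1)) ≤ _)) hwi
  have h6 := mul_le_mul_of_nonneg_right (mul_le_mul_of_nonneg_left h1 hwi)
    (sq_nonneg (spread (a i)))
  linarith

end Path

/-! ### Almost sure convergence on the simplex. -/

section Convergence

variable {Ω χ ι : Type*} [Fintype ι] {mΩ : MeasurableSpace Ω} [MeasurableSpace χ]
  {P : Measure Ω} {L : Measure χ} [IsProbabilityMeasure L] [IsProbabilityMeasure P]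
  {X : ℕ → Ω → χ} {K : χ → ι → ℝ} {π u₀ : ι → ℝ} {U : ℕ → Ω → ι → ℝ} {w : ℕ → ℝ} {C ρ : ℝ}

/-- Almost sure convergence of the predictive recursion on a finite set. -/
lemma ae_tendsto_recursion (hK : Measurable K) (hK0 : ∀ x i, 0 ≤ K x i)
    (hKpos : ∀ᵐ x ∂L, ∀ i, 0 < K x i) (hR : MemLp (fun x => spread (K x)) 2 L)
    (hπ : π ∈ stdSimplex ℝ ι) (hπpos : ∀ i, 0 < π i)
    (hdiv : ∀ v ∈ stdSimplex ℝ ι, ∫ x, mix (K x) v / mix (K x) π ∂L ≤ 1)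
    (hid : ∀ v ∈ stdSimplex ℝ ι, ((fun x => mix (K x) v) =ᵐ[L] fun x => mix (K x) π) → v = π)
    (hX : ∀ i, 1 ≤ i → Measurable (X i)) (hmap : ∀ i, 1 ≤ i → P.map (X i) = L)
    (hρ0 : 0 < ρ) (hρ1 : ρ < 1) (hC : 0 ≤ C)
    (hdep : ∀ s n, 1 ≤ s → 1 ≤ n → ∀ Φ : (Fin s → χ) → χ → ℝ, Measurable (Function.uncurry Φ) →
      (∀ y x, |Φ y x| ≤ spread (K x)) →
      ∫ ω, Φ (past X s ω) (X (s + n) ω) ∂P - ∫ ω, ∫ x, Φ (past X s ω) x ∂L ∂P ≤ C * ρ ^ n)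
    (hw : ∀ i, 1 ≤ i → 0 < w i ∧ w i ≤ 1) (hB1 : CondB1 w)
    (hu₀ : u₀ ∈ stdSimplex ℝ ι) (hu₀pos : ∀ i, 0 < u₀ i) (hU0 : ∀ ω, U 0 ω = u₀)
    (hU : ∀ n ω, U (n + 1) ω = step (w (n + 1)) (K (X (n + 1) ω)) (U n ω)) :
    ∀ᵐ ω ∂P, Tendsto (fun n => U n ω) atTop (𝓝 π) := by
  obtain ⟨-, hw0, α, hα, hα1, hΘ⟩ := hB1
  have hwpos : ∀ i, 1 ≤ i → 0 < w i := fun i hi => (hw i hi).1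
  have hwnn : ∀ i, 1 ≤ i → 0 ≤ w i := fun i hi => (hwpos i hi).le
  obtain ⟨t, ht, ht0, hw4, hW2, hρs, hWs⟩ :=
    exists_block_boundaries hwpos hw0 hα hα1 hΘ hρ0 hρ1
  change Summable fun j => blockWeight w t j ^ 2 at hW2
  change ¬ Summable fun j => blockWeight w t j at hWs
  have hUm := measurable_recursion hK hX hU0 hU
  have hnoise := ae_exists_tendsto_sum_blockNoise (π := π) hK hK0 hR hX hmap hUm hρ0 hρ1 hC hdep
    hwnn ht ht0 hW2 hρs
  have hWnn := blockWeight_nonneg hwnn t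
  have hlt : ∀ j, t j < t (j + 1) := fun j => ht (Nat.lt_succ_self j)
  have hmem : ∀ {j i}, i ∈ Finset.Ioc (t j) (t (j + 1)) → 1 ≤ i := fun {j i} hi => by
    have := Finset.mem_Ioc.1 hi; omega
  -- The cost of anchoring together with the quadratic terms. Its mean is at most a constant times
  -- the squared weights of two adjacent blocks, hence summable.
  obtain ⟨e, he⟩ : ∃ e : ℕ → Ω → ℝ, e = fun j ω =>
    3 * (blockWeight w t j + blockWeight w t (j + 1)) *
      ∑ i ∈ Finset.Ioc (t (j + 1)) (t (j + 1 + 1)), w i * spread (K (X i ω)) ^ 2 := ⟨_, rfl⟩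
  have hei : ∀ {j}, ∀ i ∈ Finset.Ioc (t (j + 1)) (t (j + 1 + 1)),
      Integrable (fun ω => w i * spread (K (X i ω)) ^ 2) P := fun i hi =>
    (memLp_spread_comp hX hmap hR (hmem hi)).integrable_sq.const_mul _
  have hW2' : Summable fun j => blockWeight w t (j + 1) ^ 2 :=
    (summable_nat_add_iff (f := fun j => blockWeight w t j ^ 2) 1).2 hW2
  have hcs := (hW2.add hW2').mul_left (6 * ∫ x, spread (K x) ^ 2 ∂L)
  have herr : ∀ᵐ ω ∂P, Summable fun j => e j ω := by
    refine ae_summable_of_summable_integral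
      (c := fun j => 6 * (∫ x, spread (K x) ^ 2 ∂L) *
        (blockWeight w t j ^ 2 + blockWeight w t (j + 1) ^ 2)) (fun j => ?_) (fun j => ?_)
      (fun j => ?_) hcs
    · rw [he]
      exact (integrable_finsetSum _ hei).const_mul _
    · rw [he]
      refine Eventually.of_forall fun ω => mul_nonneg ?_ (Finset.sum_nonneg fun i hi =>
        mul_nonneg (hwnn i (hmem hi)) (sq_nonneg _))
      linarith [hWnn j, hWnn (j + 1)]
    · have h1 : ∫ ω, e j ω ∂P = 3 * (blockWeight w t j + blockWeight w t (j + 1)) *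
          (blockWeight w t (j + 1) * ∫ x, spread (K x) ^ 2 ∂L) := by
        simp only [he]
        rw [integral_const_mul, integral_finsetSum _ hei]
        simp only [integral_const_mul]
        congr 1
        rw [blockWeight, Finset.sum_mul]
        refine Finset.sum_congr rfl fun i hi => ?_
        rw [integral_spread_comp_sq hK hX hmap (hmem hi)]
      have h2 : 0 ≤ ∫ x, spread (K x) ^ 2 ∂L := integral_nonneg fun _ => sq_nonneg _
      rw [h1]
      nlinarith [mul_nonneg h2 (sq_nonneg (blockWeight w t j - blockWeight w t (j + 1))),
        mul_nonneg h2 (sq_nonneg (blockWeight w t j))]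
  have hgood : ∀ᵐ ω ∂P, ∀ i, 1 ≤ i → ∀ k, 0 < K (X i ω) k := by
    refine ae_all_iff.2 fun i => ?_
    by_cases hi : 1 ≤ i
    · rw [← hmap i hi] at hKpos
      filter_upwards [ae_of_ae_map (hX i hi).aemeasurable hKpos] with ω hω _ using hω
    · exact Eventually.of_forall fun ω h => absurd h hi
  filter_upwards [hnoise, herr, hgood] with ω ⟨l, hl⟩ hes ha
  set y : ℕ → ι → ℝ := fun n => U n ω
  have hy : ∀ n, y (n + 1) = step (w (n + 1)) (K (X (n + 1) ω)) (y n) := fun n => hU n ω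
  have hsp := recursion_mem_stdSimplex_and_pos (a := fun i => K (X i ω)) (y := y) ha hw
    (by simpa only [y, hU0] using hu₀) (by simpa only [y, hU0] using hu₀pos) hy
  have hs : ∀ n, y n ∈ stdSimplex ℝ ι := fun n => (hsp n).1
  have hpos : ∀ n k, 0 < y n k := fun n => (hsp n).2
  -- The divergence is read at t (j + 1) but the drift at the anchor t j; the index shift is
  -- harmless once the divergence is known to converge.
  obtain ⟨⟨A, hA⟩, hfreq⟩ := tendsto_and_frequently_lt_of_le
    (A := fun j => kl π (y (t (j + 1)))) (c := fun j => blockWeight w t (j + 1))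
    (g := fun j => meanRatio L K π (y (t j)) - 1)
    (ξ := fun j => -blockNoise L K π X U w t j ω + e j ω)
    (fun j => kl_nonneg hπ hπpos (hs _) (hpos _)) (fun j => hWnn _)
    (fun j => one_le_meanRatio hK hK0 hKpos hR hπ (hs _) (hdiv _ (hs _)))
    (fun j => by
      have h1 := kl_recursion_le_of_anchor (a := fun i => K (X i ω)) (y := y) ha hwpos hπ hπpos hs
        hpos hy (hlt j).le (hlt (j + 1)).le fun i hi => hw4 i (by
          have := ht.monotone (Nat.zero_le (j + 1)); omega)
      have h2 : ∑ i ∈ Finset.Ioc (t (j + 1)) (t (j + 1 + 1)),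
          w i * (mixRatio π (K (X i ω)) (y (t j)) - 1)
          = blockNoise L K π X U w t j ω
            + blockWeight w t (j + 1) * (meanRatio L K π (y (t j)) - 1) := by
        rw [blockNoise, blockWeight, Finset.sum_mul, ← Finset.sum_add_distrib]
        refine Finset.sum_congr rfl fun i _ => ?_
        simp only [noise, y]
        ring
      have h3 : ∑ i ∈ Finset.Ioc (t j) (t (j + 1 + 1)), w i
          = blockWeight w t j + blockWeight w t (j + 1) :=
        (Finset.sum_Ioc_consecutive _ (hlt j).le (hlt (j + 1)).le).symm
      simp only [he]
      rw [h2, h3] at h1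
      linarith)
    ⟨_, (hl.neg.add hes.hasSum.tendsto_sum_nat).congr fun n => by
      rw [Finset.sum_add_distrib, Finset.sum_neg_distrib]⟩
    (fun h => hWs ((summable_nat_add_iff 1).1 h))
  have hkl : Tendsto (fun j => kl π (y (t j))) atTop (𝓝 A) := (tendsto_add_atTop_iff_nat 1).1 hA
  have hA0 : A = 0 := kl_tendsto_zero_of_frequently hK hK0 hKpos hR hπ hπpos hdiv hid
    (fun j => hs (t j)) (fun j => hpos (t j)) hkl hfreq
  rw [hA0] at hkl
  have hWt : Tendsto (fun j => blockWeight w t j) atTop (𝓝 0) := by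
    have h1 := (Real.continuous_sqrt.tendsto 0).comp hW2.tendsto_atTop_zero
    simpa only [Function.comp_def, Real.sqrt_sq (hWnn _), Real.sqrt_zero] using h1
  exact tendsto_of_tendsto_comp_of_sum_tendsto_zero ht hwnn
    (sum_abs_recursion_sub_le (a := fun i => K (X i ω)) ha hwnn hs hy) hWt
    (tendsto_of_kl_tendsto_zero hπ hπpos (fun j => hs (t j)) (fun j => hpos (t j)) hkl)

end Convergence

/-! ### Integrals against a measure with a real density. -/

section WithDensity

variable {α : Type*} [MeasurableSpace α] {κ : Measure α} {g : α → ℝ}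

lemma integral_withDensity_ofReal (hg : Measurable g) (hg0 : ∀ x, 0 ≤ g x) (h : α → ℝ) :
    ∫ x, h x ∂κ.withDensity (fun x => ENNReal.ofReal (g x)) = ∫ x, g x * h x ∂κ := by
  rw [integral_withDensity_eq_integral_toReal_smul hg.ennreal_ofReal
    (Eventually.of_forall fun _ => ENNReal.ofReal_lt_top)]
  simp only [ENNReal.toReal_ofReal (hg0 _), smul_eq_mul]

lemma integrable_withDensity_ofReal_iff (hg : Measurable g) (hg0 : ∀ x, 0 ≤ g x) {h : α → ℝ} :
    Integrable h (κ.withDensity fun x => ENNReal.ofReal (g x)) ↔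
      Integrable (fun x => g x * h x) κ := by
  rw [integrable_withDensity_iff_integrable_smul' hg.ennreal_ofReal
    (Eventually.of_forall fun _ => ENNReal.ofReal_lt_top)]
  simp only [ENNReal.toReal_ofReal (hg0 _), smul_eq_mul]

lemma ae_withDensity_ofReal_iff (hg : Measurable g) {p : α → Prop} :
    (∀ᵐ x ∂κ.withDensity fun x => ENNReal.ofReal (g x), p x) ↔ ∀ᵐ x ∂κ, 0 < g x → p x := by
  rw [ae_withDensity_iff hg.ennreal_ofReal]
  simp only [ne_eq, ENNReal.ofReal_eq_zero, not_le]

end WithDensity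

/-! ### From chi-square decay to covariance decay. -/

section Dependence

variable {Ω β χ : Type*} [MeasurableSpace Ω] [MeasurableSpace β] [MeasurableSpace χ]
  {P : Measure Ω} [IsProbabilityMeasure P] {ν : Measure χ} [SigmaFinite ν]
  {Y : Ω → β} {Z : Ω → χ} {q : β → χ → ℝ} {m R : χ → ℝ}

/-- With z = q/m - 1 the left side is m z φ, and Young's inequality with parameter r separates z
from φ. Where m = 0 the quotient carries no information, so R must vanish there. -/
lemma abs_mul_sub_le_of_abs_le {φ q m R r : ℝ} (hφ : |φ| ≤ R) (hm : 0 ≤ m) (hr : 0 < r)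
    (hR : m = 0 → R = 0) :
    q * φ - m * φ ≤ r / 2 * (m * R ^ 2) + r⁻¹ / 2 * ((q / m - 1) ^ 2 * m) := by
  rcases hm.eq_or_lt with h | h
  · have h1 : φ = 0 := abs_nonpos_iff.1 (hφ.trans (hR h.symm).le)
    simp [h1, ← h]
  · obtain ⟨z, hz⟩ : ∃ z, z = q / m - 1 := ⟨_, rfl⟩
    have hq : q = m * (1 + z) := by rw [hz]; field_simp; ring
    rw [← hz, hq]
    have h1 : φ ^ 2 ≤ R ^ 2 := sq_le_sq' (abs_le.1 hφ).1 (abs_le.1 hφ).2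
    have h2 : z * φ ≤ r / 2 * φ ^ 2 + r⁻¹ / 2 * z ^ 2 := by
      have h3 : r / 2 * φ ^ 2 + r⁻¹ / 2 * z ^ 2 - z * φ = r⁻¹ / 2 * (r * φ - z) ^ 2 := by
        field_simp; ring
      have h4 : 0 ≤ r⁻¹ / 2 * (r * φ - z) ^ 2 := by positivity
      linarith
    have h5 : r / 2 * φ ^ 2 ≤ r / 2 * R ^ 2 := mul_le_mul_of_nonneg_left h1 (by positivity)
    have h6 := mul_le_mul_of_nonneg_left (h2.trans (add_le_add h5 le_rfl)) h.le
    linarith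

/-- The chi-square distance of a conditional density from the marginal density controls the
covariances with square integrable functions. -/
lemma integral_sub_integral_le_of_chiSq (hY : Measurable Y) (hZ : Measurable Z)
    (hq : IsCondDensity P ν Y Z q) (hm : Measurable m) (hm0 : ∀ x, 0 ≤ m x)
    (hZm : P.map Z = ν.withDensity fun x => ENNReal.ofReal (m x))
    (hR : MemLp R 2 (ν.withDensity fun x => ENNReal.ofReal (m x)))
    (hR0 : ∀ x, m x = 0 → R x = 0) {c r : ℝ} (hr : 0 < r)
    (hc : ∫⁻ ω, ∫⁻ x, ENNReal.ofReal ((q (Y ω) x / m x - 1) ^ 2 * m x) ∂ν ∂P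
      ≤ ENNReal.ofReal (c ^ 2 * r ^ 2))
    {Φ : β → χ → ℝ} (hΦ : Measurable (Function.uncurry Φ)) (hΦR : ∀ y x, |Φ y x| ≤ R x) :
    ∫ ω, Φ (Y ω) (Z ω) ∂P
        - ∫ ω, ∫ x, Φ (Y ω) x ∂(ν.withDensity fun x => ENNReal.ofReal (m x)) ∂P
      ≤ ((∫ x, R x ^ 2 ∂(ν.withDensity fun x => ENNReal.ofReal (m x))) + c ^ 2) / 2 * r := by
  obtain ⟨hqm, hq0, hlaw⟩ := hq
  set L := ν.withDensity fun x => ENNReal.ofReal (m x) with hL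
  set Q := P.map Y with hQ
  have : IsProbabilityMeasure Q := Measure.isProbabilityMeasure_map hY.aemeasurable
  have : IsProbabilityMeasure L := by
    rw [← hZm]; exact Measure.isProbabilityMeasure_map hZ.aemeasurable
  have hR1 : Integrable R L := hR.integrable (by norm_num)
  have hYZ : Measurable fun ω => (Y ω, Z ω) := hY.prodMk hZ
  have hqm' : Measurable fun z : β × χ => q z.1 z.2 := hqm
  have hΦ' : Measurable fun z : β × χ => Φ z.1 z.2 := hΦ
  -- the joint expectation
  have hiΦ : Integrable (fun ω => Φ (Y ω) (Z ω)) P := by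
    have h1 : Integrable (fun ω => R (Z ω)) P := by
      rw [← hZm] at hR1
      exact hR1.comp_measurable hZ
    exact h1.mono' (hΦ'.comp hYZ).aestronglyMeasurable (Eventually.of_forall fun ω => hΦR _ _)
  have hiq : Integrable (fun z : β × χ => q z.1 z.2 * Φ z.1 z.2) (Q.prod ν) := by
    rw [← integrable_withDensity_ofReal_iff hqm' fun z => hq0 _ _, ← hlaw,
      integrable_map_measure hΦ'.aestronglyMeasurable hYZ.aemeasurable]
    exact hiΦ
  have hE1 : ∫ ω, Φ (Y ω) (Z ω) ∂P = ∫ z, q z.1 z.2 * Φ z.1 z.2 ∂(Q.prod ν) := by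
    rw [← integral_withDensity_ofReal hqm' fun z => hq0 _ _, ← hlaw,
      integral_map hYZ.aemeasurable hΦ'.aestronglyMeasurable]
  -- the product expectation
  have him2 : Integrable (fun z : β × χ => m z.2 * R z.2 ^ 2) (Q.prod ν) :=
    (((integrable_withDensity_ofReal_iff hm hm0).1 hR.integrable_sq).comp_snd Q)
  have himR : Integrable (fun z : β × χ => m z.2 * R z.2) (Q.prod ν) :=
    (((integrable_withDensity_ofReal_iff hm hm0).1 hR1).comp_snd Q)
  have him : Integrable (fun z : β × χ => m z.2 * Φ z.1 z.2) (Q.prod ν) := by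
    refine himR.mono' ((hm.comp measurable_snd).mul hΦ').aestronglyMeasurable
      (Eventually.of_forall fun z => ?_)
    rw [norm_mul, Real.norm_eq_abs, Real.norm_eq_abs, abs_of_nonneg (hm0 _)]
    exact mul_le_mul_of_nonneg_left (hΦR _ _) (hm0 _)
  have hE2 : ∫ ω, ∫ x, Φ (Y ω) x ∂L ∂P = ∫ z, m z.2 * Φ z.1 z.2 ∂(Q.prod ν) := by
    rw [integral_prod _ him, hQ, integral_map hY.aemeasurable
      (hQ ▸ him.integral_prod_left.aestronglyMeasurable)]
    simp only [hL, integral_withDensity_ofReal hm hm0]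
  have hEm : ∫ z : β × χ, m z.2 * R z.2 ^ 2 ∂(Q.prod ν) = ∫ x, R x ^ 2 ∂L := by
    rw [integral_prod _ him2, hL, integral_withDensity_ofReal hm hm0]
    simp
  -- the chi-square distance
  have hdm : Measurable fun z : β × χ => (q z.1 z.2 / m z.2 - 1) ^ 2 * m z.2 := by fun_prop
  have hd0 : ∀ z : β × χ, 0 ≤ (q z.1 z.2 / m z.2 - 1) ^ 2 * m z.2 := fun z =>
    mul_nonneg (sq_nonneg _) (hm0 _)
  have hdl : ∫⁻ z : β × χ, ENNReal.ofReal ((q z.1 z.2 / m z.2 - 1) ^ 2 * m z.2) ∂(Q.prod ν)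
      ≤ ENNReal.ofReal (c ^ 2 * r ^ 2) := by
    rw [lintegral_prod _ hdm.ennreal_ofReal.aemeasurable, hQ,
      lintegral_map hdm.ennreal_ofReal.lintegral_prod_right' hY]
    exact hc
  have hdi : Integrable (fun z : β × χ => (q z.1 z.2 / m z.2 - 1) ^ 2 * m z.2) (Q.prod ν) := by
    refine ⟨hdm.aestronglyMeasurable, ?_⟩
    rw [hasFiniteIntegral_iff_ofReal (Eventually.of_forall hd0)]
    exact hdl.trans_lt ENNReal.ofReal_lt_top
  have hdc : ∫ z : β × χ, (q z.1 z.2 / m z.2 - 1) ^ 2 * m z.2 ∂(Q.prod ν) ≤ c ^ 2 * r ^ 2 := by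
    rw [integral_eq_lintegral_of_nonneg_ae (Eventually.of_forall hd0) hdm.aestronglyMeasurable]
    exact ENNReal.toReal_le_of_le_ofReal (by positivity) hdl
  rw [hE1, hE2, ← integral_sub hiq him]
  -- Taking as Young parameter the r of the chi-square bound c² r² makes both terms linear in r.
  calc _ ≤ ∫ z : β × χ, (r / 2 * (m z.2 * R z.2 ^ 2)
        + r⁻¹ / 2 * ((q z.1 z.2 / m z.2 - 1) ^ 2 * m z.2)) ∂(Q.prod ν) :=
        integral_mono (hiq.sub him) ((him2.const_mul _).add (hdi.const_mul _)) fun z =>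
          abs_mul_sub_le_of_abs_le (hΦR _ _) (hm0 _) hr (hR0 _)
    _ = r / 2 * (∫ x, R x ^ 2 ∂L)
        + r⁻¹ / 2 * ∫ z : β × χ, (q z.1 z.2 / m z.2 - 1) ^ 2 * m z.2 ∂(Q.prod ν) := by
        rw [integral_add (him2.const_mul _) (hdi.const_mul _), integral_const_mul,
          integral_const_mul, hEm]
    _ ≤ r / 2 * (∫ x, R x ^ 2 ∂L) + r⁻¹ / 2 * (c ^ 2 * r ^ 2) :=
        add_le_add le_rfl (mul_le_mul_of_nonneg_left hdc (by positivity))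
    _ = _ := by field_simp

end Dependence

/-! ### Translation between mixing densities on `Θ` and points of the simplex. -/

section FiniteSupport

variable {E χ : Type*} [MeasurableSpace E] {μ : Measure E} {Θ : Finset E}

lemma measure_singleton_lt_top_of_sigmaFinite (μ : Measure E) [SigmaFinite μ] (θ : E) :
    μ {θ} < ∞ := by
  have h : θ ∈ ⋃ n, spanningSets μ n := by rw [iUnion_spanningSets]; trivial
  obtain ⟨n, hn⟩ := Set.mem_iUnion.1 h
  exact (measure_mono (Set.singleton_subset_iff.2 hn)).trans_lt (measure_spanningSets_lt_top μ n)

lemma real_singleton_pos [SigmaFinite μ] {θ : E} (h : 0 < μ {θ}) : 0 < μ.real {θ} :=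
  ENNReal.toReal_pos h.ne' (measure_singleton_lt_top_of_sigmaFinite μ θ).ne

/-- The masses that the density `g` gives to the points of `Θ`. -/
noncomputable def masses (μ : Measure E) (Θ : Finset E) (g : E → ℝ) (θ : Θ) : ℝ :=
  g θ * μ.real {(θ : E)}

lemma masses_pos [SigmaFinite μ] {g : E → ℝ} (hμ : ∀ θ ∈ Θ, 0 < μ {θ}) (hg : IsMixingDensityOn μ Θ g)
    (hs : Function.support g = Θ) (θ : Θ) : 0 < masses μ Θ g θ := by
  have h1 : (θ : E) ∈ Function.support g := by rw [hs]; exact θ.2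
  exact mul_pos (lt_of_le_of_ne (hg.1 θ) (Ne.symm h1)) (real_singleton_pos (hμ θ θ.2))

lemma estimate_eq_zero {p : χ → E → ℝ} {w : ℕ → ℝ} {f₀ : E → ℝ} {x : ℕ → χ} {θ : E}
    (h : f₀ θ = 0) (n : ℕ) : estimate p μ w f₀ x n θ = 0 := by
  induction n with
  | zero => exact h
  | succ n ih => simp [estimate, ih]

variable [MeasurableSingletonClass E] [SigmaFinite μ]

lemma integral_eq_sum_of_forall_notMem {h : E → ℝ} (hh : ∀ θ, θ ∉ Θ → h θ = 0) :
    ∫ θ, h θ ∂μ = ∑ θ : Θ, h θ * μ.real {(θ : E)} := by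
  classical
  have h1 : ∀ x, h x = ∑ θ ∈ Θ, Set.indicator {θ} (fun _ => h θ) x := fun x => by
    simp only [Set.indicator_apply, Set.mem_singleton_iff, Finset.sum_ite_eq]
    split_ifs with hx
    · rfl
    · exact hh x hx
  rw [integral_congr_ae (Eventually.of_forall h1), integral_finsetSum]
  · rw [← Finset.sum_coe_sort Θ]
    refine Finset.sum_congr rfl fun θ _ => ?_
    rw [integral_indicator_const _ (measurableSet_singleton _), smul_eq_mul, mul_comm]
  · intro θ _
    rw [integrable_indicator_iff (measurableSet_singleton _)]
    exact integrableOn_const (measure_singleton_lt_top_of_sigmaFinite μ θ).ne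

lemma mixture_eq_mix {p : χ → E → ℝ} {g : E → ℝ} (hg : ∀ θ, θ ∉ Θ → g θ = 0) (x : χ) :
    mixture p μ g x = mix (fun θ : Θ => p x θ) (masses μ Θ g) := by
  rw [mixture, integral_eq_sum_of_forall_notMem (Θ := Θ) fun θ hθ => by rw [hg θ hθ, mul_zero]]
  exact Finset.sum_congr rfl fun θ _ => by rw [masses]; ring

lemma masses_mem_stdSimplex {g : E → ℝ} (hg : IsMixingDensityOn μ Θ g) :
    masses μ Θ g ∈ stdSimplex ℝ Θ := by
  refine ⟨fun θ => mul_nonneg (hg.1 θ) measureReal_nonneg, ?_⟩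
  rw [← hg.2.2, integral_eq_sum_of_forall_notMem (Θ := Θ) hg.2.1]
  rfl

/-- The recursion is multiplicative in the density at each θ, so the factor μ{θ} passes through it.
-/
lemma masses_estimate_succ {p : χ → E → ℝ} {w : ℕ → ℝ} {f₀ : E → ℝ} (x : ℕ → χ)
    (h : ∀ θ, θ ∉ Θ → f₀ θ = 0) (n : ℕ) :
    masses μ Θ (estimate p μ w f₀ x (n + 1))
      = step (w (n + 1)) (fun θ : Θ => p (x (n + 1)) θ) (masses μ Θ (estimate p μ w f₀ x n)) := by
  ext θ
  rw [step, ← mixture_eq_mix fun θ hθ => estimate_eq_zero (h θ hθ) n]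
  simp only [masses, estimate]
  ring

/-- Since each point of `Θ` has positive finite mass, weights can be divided back into densities;
this transfers identifiability to the simplex. -/
lemma exists_isMixingDensityOn_masses_eq (hμ : ∀ θ ∈ Θ, 0 < μ {θ}) {v : Θ → ℝ}
    (hv : v ∈ stdSimplex ℝ Θ) : ∃ g, IsMixingDensityOn μ Θ g ∧ masses μ Θ g = v := by
  classical
  let g : E → ℝ := fun θ => if h : θ ∈ Θ then v ⟨θ, h⟩ / μ.real {θ} else 0
  have hg0 : ∀ θ, θ ∉ Θ → g θ = 0 := fun θ hθ => dif_neg hθ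
  have hgv : masses μ Θ g = v := by
    ext θ
    simp only [masses, g, dif_pos θ.2]
    exact div_mul_cancel₀ _ (real_singleton_pos (hμ θ θ.2)).ne'
  refine ⟨g, ⟨fun θ => ?_, hg0, ?_⟩, hgv⟩
  · simp only [g]
    split_ifs with h
    · exact div_nonneg (hv.1 _) measureReal_nonneg
    · exact le_rfl
  · rw [integral_eq_sum_of_forall_notMem hg0, ← hv.2, ← hgv]
    rfl

end FiniteSupport

/-! ### Consequences of B3 for the marginal law. -/

section Densities

lemma ofReal_div_le_ratio {E χ : Type*} {p : χ → E → ℝ} {x : χ} {θ₂ : E} (h₂ : 0 ≤ p x θ₂) (θ₁ : E) :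
    ENNReal.ofReal (p x θ₁ / p x θ₂) ≤ ratio p x θ₁ θ₂ := by
  rcases h₂.eq_or_lt with h | h
  · simp [← h]
  · rw [ENNReal.ofReal_div_of_pos h, ratio]

variable {E χ : Type*} [MeasurableSpace χ] {ν : Measure χ} {p : χ → E → ℝ} {S : Set E} {Θ : Finset E}
  {π : Θ → ℝ}

lemma mix_nonneg {ι : Type*} [Fintype ι] {a u : ι → ℝ} (ha : ∀ i, 0 ≤ a i) (hu : ∀ i, 0 ≤ u i) :
    0 ≤ mix a u := Finset.sum_nonneg fun i _ => mul_nonneg (hu i) (ha i)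

lemma eq_zero_of_mix_eq_zero {ι : Type*} [Fintype ι] {a u : ι → ℝ} (ha : ∀ i, 0 ≤ a i)
    (hu : ∀ i, 0 < u i) (h : mix a u = 0) (i : ι) : a i = 0 := by
  have h1 := (Finset.sum_eq_zero_iff_of_nonneg fun i _ => mul_nonneg (hu i).le (ha i)).1 h i
    (Finset.mem_univ i)
  exact (mul_eq_zero.1 h1).resolve_left (hu i).ne'

/-- Where the numerator is positive and the denominator vanishes, the ratio is ∞; B3 with θ₃ = θ₁
gives the integrand positive density there, so this set is null. -/
lemma ae_imp_pos_of_condB3 (hp : IsDensityFamily ν S p) (hB3 : CondB3 ν p S) {θ₁ θ₂ : E}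
    (h₁ : θ₁ ∈ S) (h₂ : θ₂ ∈ S) : ∀ᵐ x ∂ν, 0 < p x θ₁ → 0 < p x θ₂ := by
  obtain ⟨B, hB⟩ := hB3
  have hm : Measurable fun x => ratio p x θ₁ θ₂ ^ 2 * ENNReal.ofReal (p x θ₁) :=
    ((((hp θ₁ h₁).1.ennreal_ofReal).div (hp θ₂ h₂).1.ennreal_ofReal).pow_const 2).mul
      (hp θ₁ h₁).1.ennreal_ofReal
  filter_upwards [ae_lt_top hm ((hB θ₁ h₁ θ₂ h₂ θ₁ h₁).trans_lt ENNReal.ofReal_lt_top).ne]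
    with x hx hpos
  by_contra hle
  have h1 : ENNReal.ofReal (p x θ₁) ≠ 0 := (ENNReal.ofReal_pos.2 hpos).ne'
  rw [ratio, ENNReal.ofReal_of_nonpos (not_lt.1 hle), ENNReal.div_zero h1] at hx
  simp [h1, ENNReal.top_mul] at hx

lemma ae_pos_of_condB3 (hp : IsDensityFamily ν S p) (hB3 : CondB3 ν p S) (hΘ : (Θ : Set E) ⊆ S)
    (hπ : ∀ θ, 0 < π θ) (hm : Measurable fun x => mix (fun θ : Θ => p x θ) π) :
    ∀ᵐ x ∂ν.withDensity (fun x => ENNReal.ofReal (mix (fun θ : Θ => p x θ) π)),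
      ∀ θ : Θ, 0 < p x θ := by
  rw [ae_withDensity_ofReal_iff hm]
  have h : ∀ᵐ x ∂ν, ∀ θ₁ θ₂ : Θ, 0 < p x θ₁ → 0 < p x θ₂ :=
    ae_all_iff.2 fun θ₁ => ae_all_iff.2 fun θ₂ =>
      ae_imp_pos_of_condB3 hp hB3 (hΘ θ₁.2) (hΘ θ₂.2)
  filter_upwards [h] with x hx hpos θ
  obtain ⟨θ₁, -, h1⟩ := Finset.exists_lt_of_sum_lt (s := Finset.univ) (f := fun _ => (0 : ℝ))
    (g := fun θ : Θ => π θ * p x θ) (by rw [Finset.sum_const_zero]; exact hpos)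
  exact hx θ₁ θ (pos_of_mul_pos_right h1 (hπ θ₁).le)

/-- The marginal law is a finite mixture of the laws p(· | θ₃), so B3 bounds each squared ratio
termwise. The real quotient, 0 over a zero denominator, is below the extended one. -/
lemma memLp_spread_of_condB3 (hp : IsDensityFamily ν S p) (hB3 : CondB3 ν p S)
    (hΘ : (Θ : Set E) ⊆ S) (hπ : ∀ θ, 0 ≤ π θ)
    (hm : Measurable fun x => mix (fun θ : Θ => p x θ) π) :
    MemLp (fun x => spread fun θ : Θ => p x θ) 2
      (ν.withDensity fun x => ENNReal.ofReal (mix (fun θ : Θ => p x θ) π)) := by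
  obtain ⟨B, hB⟩ := hB3
  refine memLp_finsetSum _ fun θ₁ _ => memLp_finsetSum _ fun θ₂ _ => ?_
  have hq : Measurable fun x => p x θ₁ / p x θ₂ := (hp θ₁ (hΘ θ₁.2)).1.div (hp θ₂ (hΘ θ₂.2)).1
  rw [memLp_two_iff_integrable_sq hq.aestronglyMeasurable]
  refine ⟨(hq.pow_const 2).aestronglyMeasurable, ?_⟩
  rw [hasFiniteIntegral_iff_ofReal (Eventually.of_forall fun _ => sq_nonneg _),
    lintegral_withDensity_eq_lintegral_mul _ hm.ennreal_ofReal (hq.pow_const 2).ennreal_ofReal]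
  have hterm : ∀ θ₃ : Θ, Measurable fun x =>
      ENNReal.ofReal (π θ₃) * (ratio p x θ₁ θ₂ ^ 2 * ENNReal.ofReal (p x θ₃)) := fun θ₃ =>
    (((((hp θ₁ (hΘ θ₁.2)).1.ennreal_ofReal).div (hp θ₂ (hΘ θ₂.2)).1.ennreal_ofReal).pow_const
      2).mul (hp θ₃ (hΘ θ₃.2)).1.ennreal_ofReal).const_mul _
  calc _ ≤ ∫⁻ x, ∑ θ₃ : Θ,
        ENNReal.ofReal (π θ₃) * (ratio p x θ₁ θ₂ ^ 2 * ENNReal.ofReal (p x θ₃)) ∂ν := by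
        refine lintegral_mono fun x => ?_
        have h0 : ∀ θ : Θ, 0 ≤ p x θ := fun θ => (hp θ (hΘ θ.2)).2.1 x
        have h1 : ENNReal.ofReal ((p x θ₁ / p x θ₂) ^ 2) ≤ ratio p x θ₁ θ₂ ^ 2 := by
          rw [ENNReal.ofReal_pow (div_nonneg (h0 θ₁) (h0 θ₂))]
          exact pow_le_pow_left' (ofReal_div_le_ratio (h0 θ₂) _) 2
        simp only [Pi.mul_apply, mix]
        rw [ENNReal.ofReal_sum_of_nonneg fun θ _ => mul_nonneg (hπ θ) (h0 θ), Finset.sum_mul]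
        refine Finset.sum_le_sum fun θ₃ _ => ?_
        rw [ENNReal.ofReal_mul (hπ θ₃), mul_assoc, mul_comm (ENNReal.ofReal (p x θ₃))]
        gcongr
    _ = ∑ θ₃ : Θ, ENNReal.ofReal (π θ₃)
          * ∫⁻ x, ratio p x θ₁ θ₂ ^ 2 * ENNReal.ofReal (p x θ₃) ∂ν := by
        rw [lintegral_finsetSum _ fun θ₃ _ => hterm θ₃]
        refine Finset.sum_congr rfl fun θ₃ _ => ?_
        rw [lintegral_const_mul' _ _ ENNReal.ofReal_ne_top]
    _ < ∞ := by
        refine ENNReal.sum_lt_top.2 fun θ₃ _ => ENNReal.mul_lt_top ENNReal.ofReal_lt_top ?_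
        exact (hB _ (hΘ θ₁.2) _ (hΘ θ₂.2) _ (hΘ θ₃.2)).trans_lt ENNReal.ofReal_lt_top

/-- The density m_π cancels the denominator where it is positive, leaving the integral of m_v over
{m_π > 0}, at most its total mass 1. -/
lemma integral_mix_div_mix_le_one (hp : IsDensityFamily ν S p) (hΘ : (Θ : Set E) ⊆ S)
    (hπ : ∀ θ, 0 ≤ π θ) (hm : Measurable fun x => mix (fun θ : Θ => p x θ) π) {v : Θ → ℝ}
    (hv : v ∈ stdSimplex ℝ Θ) :
    ∫ x, mix (fun θ : Θ => p x θ) v / mix (fun θ : Θ => p x θ) π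
      ∂(ν.withDensity fun x => ENNReal.ofReal (mix (fun θ : Θ => p x θ) π)) ≤ 1 := by
  have h0 : ∀ x, ∀ θ : Θ, 0 ≤ p x θ := fun x θ => (hp θ (hΘ θ.2)).2.1 x
  have hi : ∀ θ : Θ, Integrable (fun x => p x θ) ν := fun θ => by
    refine ⟨(hp θ (hΘ θ.2)).1.aestronglyMeasurable, ?_⟩
    rw [hasFiniteIntegral_iff_ofReal (Eventually.of_forall fun x => h0 x θ), (hp θ (hΘ θ.2)).2.2]
    exact ENNReal.one_lt_top
  have h1 : ∀ θ : Θ, ∫ x, p x θ ∂ν = 1 := fun θ => by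
    rw [integral_eq_lintegral_of_nonneg_ae (Eventually.of_forall fun x => h0 x θ)
      (hp θ (hΘ θ.2)).1.aestronglyMeasurable, (hp θ (hΘ θ.2)).2.2, ENNReal.toReal_one]
  rw [integral_withDensity_ofReal hm fun x => mix_nonneg (h0 x) hπ]
  calc _ ≤ ∫ x, mix (fun θ : Θ => p x θ) v ∂ν := by
        refine integral_mono_of_nonneg (Eventually.of_forall fun x => ?_)
          (integrable_finsetSum _ fun θ _ => (hi θ).const_mul (v θ))
          (Eventually.of_forall fun x => ?_)
        · exact mul_nonneg (mix_nonneg (h0 x) hπ)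
            (div_nonneg (mix_nonneg (h0 x) hv.1) (mix_nonneg (h0 x) hπ))
        · refine le_of_eq_of_le (mul_div_left_comm _ _ _) ?_
          exact mul_le_of_le_one_right (mix_nonneg (h0 x) hv.1) (div_self_le_one _)
    _ = 1 := by
        simp only [mix]
        rw [integral_finsetSum _ fun θ _ => (hi θ).const_mul (v θ)]
        simp only [integral_const_mul, h1, mul_one, hv.2]

end Densities

/-! ### Assembly for finitely supported mixing densities. -/

section Main

variable {Ω χ E : Type*} [MeasurableSpace Ω] [MeasurableSpace χ] [MeasurableSpace E]
  [MeasurableSingletonClass E] {P : Measure Ω} [IsProbabilityMeasure P] {ν : Measure χ}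
  [SigmaFinite ν] {μ : Measure E} [SigmaFinite μ] {Θ : Finset E} {S : Set E} {p : χ → E → ℝ}
  {f f₀ : E → ℝ} {w : ℕ → ℝ} {X : ℕ → Ω → χ}

/-- Almost sure convergence of the predictive recursion estimates for a finitely supported mixing
density. The dependence decay and the moment condition B3 suffice. -/
theorem ae_tendsto_estimate (hΘ : (Θ : Set E) ⊆ S) (hp : IsDensityFamily ν S p)
    (hμ : ∀ θ ∈ Θ, 0 < μ {θ})
    (hf : IsMixingDensityOn μ Θ f) (hfsupp : Function.support f = Θ)
    (hf₀ : IsMixingDensityOn μ Θ f₀) (hf₀supp : Function.support f₀ = Θ)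
    (hid : Identifiable ν μ Θ p) (hX : ∀ i, 1 ≤ i → Measurable (X i))
    (hmarg : ∀ i, 1 ≤ i → P.map (X i) = ν.withDensity fun x => ENNReal.ofReal (mixture p μ f x))
    (hdep : DependenceDecay P ν X (mixture p μ f)) (hw : ∀ i, 1 ≤ i → 0 < w i ∧ w i ≤ 1)
    (hB1 : CondB1 w) (hB3 : CondB3 ν p S) :
    ∀ᵐ ω ∂P, ∀ θ, Tendsto (fun n => estimate p μ w f₀ (fun i => X i ω) n θ) atTop (𝓝 (f θ)) := by
  set K : χ → Θ → ℝ := fun x θ => p x θ with hKdef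
  set π : Θ → ℝ := masses μ Θ f with hπdef
  have hK : Measurable K := measurable_pi_lambda _ fun θ => (hp θ (hΘ θ.2)).1
  have hK0 : ∀ x θ, 0 ≤ K x θ := fun x θ => (hp θ (hΘ θ.2)).2.1 x
  have hπ : π ∈ stdSimplex ℝ Θ := masses_mem_stdSimplex hf
  have hπpos : ∀ θ, 0 < π θ := masses_pos hμ hf hfsupp
  have hmix : mixture p μ f = fun x => mix (K x) π := funext fun x => mixture_eq_mix hf.2.1 x
  have hm : Measurable fun x => mix (K x) π :=
    measurable_mix.comp (hK.prodMk measurable_const)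
  have hm0 : ∀ x, 0 ≤ mix (K x) π := fun x => mix_nonneg (hK0 x) hπ.1
  have hzero : ∀ x, mix (K x) π = 0 → ∀ θ, K x θ = 0 := fun x =>
    eq_zero_of_mix_eq_zero (hK0 x) hπpos
  rw [hmix] at hmarg hdep
  set L := ν.withDensity fun x => ENNReal.ofReal (mix (K x) π) with hL
  have : IsProbabilityMeasure L := by
    rw [← hmarg 1 le_rfl]
    exact Measure.isProbabilityMeasure_map (hX 1 le_rfl).aemeasurable
  have hKpos : ∀ᵐ x ∂L, ∀ θ, 0 < K x θ := ae_pos_of_condB3 hp hB3 hΘ hπpos hm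
  have hR : MemLp (fun x => spread (K x)) 2 L := memLp_spread_of_condB3 hp hB3 hΘ hπ.1 hm
  have hident : ∀ v ∈ stdSimplex ℝ Θ,
      ((fun x => mix (K x) v) =ᵐ[L] fun x => mix (K x) π) → v = π := fun v hv h => by
    obtain ⟨g, hg, rfl⟩ := exists_isMixingDensityOn_masses_eq hμ hv
    rw [hπdef, hid g f hg hf]
    have h1 := (ae_withDensity_ofReal_iff hm).1 h
    filter_upwards [h1] with x hx
    rw [mixture_eq_mix hg.2.1, mixture_eq_mix hf.2.1]
    -- The hypothesis holds only L-almost everywhere, whereas identifiability is stated for ν. On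
    -- {m_π = 0} all kernels over `Θ` vanish, since π is positive, and both mixtures are 0.
    rcases (hm0 x).eq_or_lt with h0 | h0
    · have h2 := hzero x h0.symm
      have h3 : ∀ u : Θ → ℝ, mix (K x) u = 0 := fun u =>
        Finset.sum_eq_zero fun θ _ => by rw [h2, mul_zero]
      exact (h3 _).trans (h3 _).symm
    · exact hx h0
  obtain ⟨c₀, ρ, -, hρ0, hρ1, hdec⟩ := hdep
  set U : ℕ → Ω → Θ → ℝ := fun n ω => masses μ Θ (estimate p μ w f₀ (fun i => X i ω) n)
  have hlim : ∀ᵐ ω ∂P, Tendsto (fun n => U n ω) atTop (𝓝 π) := by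
    refine ae_tendsto_recursion (C := ((∫ x, spread (K x) ^ 2 ∂L) + c₀ ^ 2) / 2) hK hK0 hKpos hR hπ
      hπpos (fun v hv => integral_mix_div_mix_le_one hp hΘ hπ.1 hm hv) hident hX hmarg hρ0 hρ1
      ?_ (fun s n hs hn Φ hΦ hΦR => ?_) hw hB1 (masses_mem_stdSimplex hf₀)
      (masses_pos hμ hf₀ hf₀supp) (fun ω => rfl)
      (fun n ω => masses_estimate_succ (fun i => X i ω) hf₀.2.1 n)
    · have : 0 ≤ ∫ x, spread (K x) ^ 2 ∂L := integral_nonneg fun _ => sq_nonneg _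
      positivity
    · obtain ⟨q, hq, hqc⟩ := hdec s n hs hn
      refine integral_sub_integral_le_of_chiSq (measurable_past hX s) (hX (s + n) (by omega)) hq hm
        hm0 (hmarg _ (by omega)) hR (fun x hx => ?_) (pow_pos hρ0 n) ?_ hΦ hΦR
      -- With 0/0 = 0 the `spread` vanishes wherever the marginal density does.
      · exact Finset.sum_eq_zero fun θ₁ _ => Finset.sum_eq_zero fun θ₂ _ => by
          rw [hzero x hx, zero_div]
      · rwa [← pow_mul, mul_comm n 2]
  filter_upwards [hlim] with ω hω θ
  by_cases hθ : θ ∈ Θ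
  · have hmass := (real_singleton_pos (hμ θ hθ)).ne'
    have h1 := ((tendsto_pi_nhds.1 hω) ⟨θ, hθ⟩).div_const (μ.real {θ})
    simpa only [U, hπdef, masses, mul_div_cancel_right₀ _ hmass] using h1
  · rw [hf.2.1 θ hθ]
    simp only [estimate_eq_zero (hf₀.2.1 θ hθ)]
    exact tendsto_const_nhds

end Main

end PredictiveRecursion

theorem mainTheorem2 {Ω χ : Type*} [MeasurableSpace Ω] [TopologicalSpace χ] [MeasurableSpace χ]
    {d : ℕ}
    (P : Measure Ω) [IsProbabilityMeasure P] (ν : Measure χ) [SigmaFinite ν]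
    (μ : Measure (EuclideanSpace ℝ (Fin d))) [SigmaFinite μ]
    (Θ ΘH : Finset (EuclideanSpace ℝ (Fin d))) (Θhat : Set (EuclideanSpace ℝ (Fin d)))
    (χc : Set χ) (p : χ → EuclideanSpace ℝ (Fin d) → ℝ)
    (f f₀ : EuclideanSpace ℝ (Fin d) → ℝ) (w : ℕ → ℝ) (X : ℕ → Ω → χ)
    -- the parameter sets, the kernel and the compact set
    (hclosed : IsClosed Θhat) (hconvex : Convex ℝ Θhat)
    (hΘ : (Θ : Set (EuclideanSpace ℝ (Fin d))) ⊆ Θhat)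
    (hΘH : (ΘH : Set (EuclideanSpace ℝ (Fin d))) ⊆ Θhat)
    (hχc : IsCompact χc)
    (hp : PredictiveRecursion.IsDensityFamily ν Θhat p)
    -- the true and the initial mixing density, both with support `Θ`
    (hμ : ∀ θ ∈ Θ, 0 < μ {θ})
    (hf : PredictiveRecursion.IsMixingDensityOn μ Θ f) (hfsupp : Function.support f = Θ)
    (hf₀ : PredictiveRecursion.IsMixingDensityOn μ Θ f₀) (hf₀supp : Function.support f₀ = Θ)
    (hid : PredictiveRecursion.Identifiable ν μ Θ p)
    -- the observations `X_1, X_2, …` and their common marginal density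
    (hX : ∀ i, 1 ≤ i → Measurable (X i))
    (hmarg : ∀ i, 1 ≤ i → P.map (X i) =
      ν.withDensity (fun x => ENNReal.ofReal (PredictiveRecursion.mixture p μ f x)))
    (hdep : PredictiveRecursion.DependenceDecay P ν X (PredictiveRecursion.mixture p μ f))
    -- the weights
    (hw : ∀ i, 1 ≤ i → 0 < w i ∧ w i ≤ 1)
    (hB1 : PredictiveRecursion.CondB1 w)
    (hB2 : PredictiveRecursion.CondB2 P X p Θhat)
    (hB3 : PredictiveRecursion.CondB3 ν p Θhat)
    (hB4 : PredictiveRecursion.CondB4 p (Θ : Set (EuclideanSpace ℝ (Fin d))))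
    (hC1 : PredictiveRecursion.CondC1 p (Θ : Set (EuclideanSpace ℝ (Fin d)))
      (ΘH : Set (EuclideanSpace ℝ (Fin d))) χc)
    (hC2 : PredictiveRecursion.CondC2 p (Θ : Set (EuclideanSpace ℝ (Fin d))) χc)
    (hC3 : PredictiveRecursion.CondC3 p (Θ : Set (EuclideanSpace ℝ (Fin d))) χc) :
    ∀ᵐ ω ∂P, ∀ θ, Tendsto
      (fun n => PredictiveRecursion.estimate p μ w f₀ (fun i => X i ω) n θ) atTop (𝓝 (f θ)) := by
  exact PredictiveRecursion.ae_tendsto_estimate hΘ hp hμ hf hfsupp hf₀ hf₀supp hid hX hmarg hdep hw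
    hB1 hB3
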